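/- Let $V$ be an $n$-dimensional real vector space with a nondegenerate quadratic form $\eta$ of any signature, $\mathrm{Cl}(V)$ its Clifford algebra, in which $vw+wv=2\eta(v,w)$, and let $\mathrm{Cl}^p(V)\subset \mathrm{Cl}(V)$ correspond to $\Lambda^p(V)$ under the canonical linear isomorphism $\mathrm{Cl}(V)\cong\Lambda(V)$ (the one that sends $1$ to $1$ and $\tfrac12(va+(-1)^{\deg a}av)$ to $v\wedge a$, for $v\in V$). Let $M$ be a smooth $n$-dimensional manifold and let $\Omega^{pq}=\Omega^q(M,\mathrm{Cl}^p(V))$ be the space of smooth $q$-forms on $M$ with values in $\mathrm{Cl}^p(V)$, multiplied by $(a\otimes\alpha)(b\otimes\beta)=ab\otimes\alpha\wedge\beta$. Let $\theta\in\Omega^{11}$ and $\omega\in\Omega^{21}$, where $\theta$ is nondegenerate: for every $x\in M$ the map $X\mapsto i_X\theta$ is an isomorphism $T_xM\to V$. Put $$t=d\theta+\omega\theta+\theta\omega,\qquad R=d\omega+\omega^2,\qquad \nabla x=dx+\omega x-(-1)^q x\omega\quad (x\in\Omega^{pq}).$$ Let $2Ex=\theta x+(-1)^{p+q}x\theta$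 for $x\in\Omega^{pq}$. Choose an invertible element $\mathrm{vol}$ of the line $\mathrm{Cl}^n(V)$ and let $*a=a\,\mathrm{vol}$ be the corresponding Hodge star on $\mathrm{Cl}(V)\cong\Lambda(V)$. Let $*_1$ be this star acting on the Clifford factor. Let $*_2$ be the same star acting on the form factor, transported by the isomorphisms $T_x^*M\cong V^*\cong V$ given by $\theta$ and $\eta$. Put $E'=*_1^{-1}E*_1$, $F'=*_2^{-1}E*_2$ and $H'=q-p$ on $\Omega^{pq}$ (these are the generators of the second $\mathfrak{sl}_2$). Then $t\in\Omega^{12}$, $R\in\Omega^{22}$, and $$\nabla t=dt+\omega t-t\omega=R\theta-\theta R=-2E'R .$$ If moreover $t=0$ on $M$, then $E'R=0$, $F'R=0$ and $H'R=0$, that is, $R$ is invariant under the second $\mathfrak{sl}_2$. In that case, at every point $x\in M$, the value $R_x$, viewed as an element of $\Lambda^2(V)\otimes\Lambda^2(V)$ through $\mathrm{Cl}^2(V)\cong\Lambda^2(V)$ and $\Lambda^2(T_x^*M)\cong\Lambda^2(V)$ (by $\theta$ and $\eta$), is symmetric, i.e. fixed by the exchange of the two tensor factors. -/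

import Mathlib

open scoped TensorProduct Manifold

noncomputable section

namespace CliffordForms

section LinearAlgebra

variable {V : Type*} [AddCommGroup V] [Module ℝ V]

instance finite_exteriorAlgebra [FiniteDimensional ℝ V] :
    Module.Finite ℝ (ExteriorAlgebra ℝ V) :=
  Module.Finite.of_basis (Module.finBasis ℝ V).ExteriorAlgebra

instance finite_cliffordAlgebra [FiniteDimensional ℝ V] (Q : QuadraticForm ℝ V) :
    Module.Finite ℝ (CliffordAlgebra Q) :=
  Module.Finite.equiv (CliffordAlgebra.equivExterior Q).symm

/-- The symmetric bilinear form `η` of `Q`, with `η v v = Q v`; so in the Clifford algebra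
`v * w + w * v = 2 η v w`. -/
abbrev eta (Q : QuadraticForm ℝ V) : LinearMap.BilinForm ℝ V := QuadraticMap.associated Q

/-- The component `Cl^p(V)`: the image of `Λ^p(V)` under the canonical (quantization)
isomorphism `Λ(V) ≃ Cl(V)` of `Λ(V)`-modules. -/
def clPart (Q : QuadraticForm ℝ V) (p : ℕ) : Submodule ℝ (CliffordAlgebra Q) :=
  (⋀[ℝ]^p V).map (CliffordAlgebra.equivExterior Q).symm.toLinearMap

/-- The Hodge star `a ↦ a * vol` of the Clifford algebra attached to an invertible element
`vol` of the line `Cl^n(V)`. It satisfies `v ∧ (*a) = *(v ⊢ a)` where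
`v ∧ a = (v a + (-1)^{deg a} a v) / 2` and `v ⊢ a = (v a - (-1)^{deg a} a v) / 2`. -/
def hodge {Q : QuadraticForm ℝ V} (vol : (CliffordAlgebra Q)ˣ) :
    CliffordAlgebra Q ≃ₗ[ℝ] CliffordAlgebra Q :=
  LinearEquiv.ofLinearMap
    (LinearMap.mulRight ℝ (vol : CliffordAlgebra Q))
    (LinearMap.mulRight ℝ ((vol⁻¹ : (CliffordAlgebra Q)ˣ) : CliffordAlgebra Q))
    (by ext x; simp [mul_assoc]) (by ext x; simp [mul_assoc])

/-- The number operator on the exterior algebra: multiplication by `p` on `Λ^p`. -/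
def numberOp (W : Type*) [AddCommGroup W] [Module ℝ W] :
    ExteriorAlgebra ℝ W →ₗ[ℝ] ExteriorAlgebra ℝ W :=
  (DirectSum.toModule ℝ ℕ (ExteriorAlgebra ℝ W) fun p => (p : ℝ) • (⋀[ℝ]^p W).subtype) ∘ₗ
    (DirectSum.decomposeLinearEquiv fun p : ℕ => ⋀[ℝ]^p W).toLinearMap

/-- Clifford forms at a point with tangent space `T`: the algebra `Cl(V) ⊗ Λ(T*)`, with
the product `(a ⊗ α) (b ⊗ β) = (a b) ⊗ (α ∧ β)`. -/
abbrev Fiber (Q : QuadraticForm ℝ V) (T : Type*) [AddCommGroup T] [Module ℝ T] : Type _ :=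
  CliffordAlgebra Q ⊗[ℝ] ExteriorAlgebra ℝ (Module.Dual ℝ T)

variable {T T' : Type*} [AddCommGroup T] [Module ℝ T] [AddCommGroup T'] [Module ℝ T']
  (Q : QuadraticForm ℝ V)

/-- The component `Cl^p(V) ⊗ Λ^q(T*)`. -/
def bidegree (T : Type*) [AddCommGroup T] [Module ℝ T] (p q : ℕ) : Submodule ℝ (Fiber Q T) :=
  LinearMap.range (TensorProduct.map (clPart Q p).subtype (⋀[ℝ]^q (Module.Dual ℝ T)).subtype)

/-- Pullback of Clifford forms along a linear map of tangent spaces. -/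
def pullback (L : T →ₗ[ℝ] T') : Fiber Q T' →ₐ[ℝ] Fiber Q T :=
  Algebra.TensorProduct.map (AlgHom.id ℝ (CliffordAlgebra Q)) (ExteriorAlgebra.map L.dualMap)

variable {Q}

/-- The sign `(-1)^q` on `Cl^p ⊗ Λ^q`. -/
def formSign : Fiber Q T →ₗ[ℝ] Fiber Q T :=
  TensorProduct.map LinearMap.id CliffordAlgebra.involute.toLinearMap

/-- The sign `(-1)^(p+q)` on `Cl^p ⊗ Λ^q`. -/
def totalSign : Fiber Q T →ₗ[ℝ] Fiber Q T :=
  TensorProduct.map CliffordAlgebra.involute.toLinearMap CliffordAlgebra.involute.toLinearMap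

/-- Interior product `i_X` of Clifford forms with a tangent vector `X`. -/
def interior (X : T) : Fiber Q T →ₗ[ℝ] Fiber Q T :=
  TensorProduct.map LinearMap.id
    (CliffordAlgebra.contractLeft (Q := (0 : QuadraticForm ℝ (Module.Dual ℝ T)))
      (Module.Dual.eval ℝ T X))

/-- `2 E x = θ x + (-1)^(p+q) x θ` for `x` of bidegree `(p, q)`. -/
def opE (θ : Fiber Q T) : Fiber Q T →ₗ[ℝ] Fiber Q T :=
  (1 / 2 : ℝ) • (LinearMap.mulLeft ℝ θ + LinearMap.mulRight ℝ θ ∘ₗ totalSign)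

/-- The Hodge star `*₁` acting on the Clifford factor. -/
def star₁ (vol : (CliffordAlgebra Q)ˣ) : Fiber Q T ≃ₗ[ℝ] Fiber Q T :=
  TensorProduct.congr (hodge vol) (LinearEquiv.refl ℝ _)

/-- `E' = *₁⁻¹ E *₁`. -/
def opE' (vol : (CliffordAlgebra Q)ˣ) (θ : Fiber Q T) : Fiber Q T →ₗ[ℝ] Fiber Q T :=
  (star₁ vol).symm.toLinearMap ∘ₗ opE θ ∘ₗ (star₁ vol).toLinearMap

variable [FiniteDimensional ℝ V]

/-- The identification `T* ≃ V* ≃ V` given by a frame `e : T ≃ V` and the form `η`. -/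
def sharp (hQ : (eta Q).Nondegenerate) (e : T ≃ₗ[ℝ] V) : Module.Dual ℝ T ≃ₗ[ℝ] V :=
  e.symm.dualMap ≪≫ₗ ((eta Q).toDual hQ).symm

/-- The induced identification `Λ(T*) ≃ Λ(V)`. -/
def sharpExt (hQ : (eta Q).Nondegenerate) (e : T ≃ₗ[ℝ] V) :
    ExteriorAlgebra ℝ (Module.Dual ℝ T) ≃ₗ[ℝ] ExteriorAlgebra ℝ V :=
  LinearEquiv.ofLinearMap
    (ExteriorAlgebra.map (sharp hQ e).toLinearMap).toLinearMap
    (ExteriorAlgebra.map (sharp hQ e).symm.toLinearMap).toLinearMap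
    (by rw [← AlgHom.comp_toLinearMap, ExteriorAlgebra.map_comp_map]; simp)
    (by rw [← AlgHom.comp_toLinearMap, ExteriorAlgebra.map_comp_map]; simp)

/-- The Hodge star of `Λ(T*)` for the metric on `T` induced from `η` by the frame `e`,
obtained by transport along `Λ(T*) ≃ Λ(V) ≃ Cl(V)`. -/
def hodgeForms (hQ : (eta Q).Nondegenerate) (vol : (CliffordAlgebra Q)ˣ) (e : T ≃ₗ[ℝ] V) :
    ExteriorAlgebra ℝ (Module.Dual ℝ T) ≃ₗ[ℝ] ExteriorAlgebra ℝ (Module.Dual ℝ T) :=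
  (sharpExt hQ e ≪≫ₗ (CliffordAlgebra.equivExterior Q).symm) ≪≫ₗ hodge vol ≪≫ₗ
    (sharpExt hQ e ≪≫ₗ (CliffordAlgebra.equivExterior Q).symm).symm

/-- The Hodge star `*₂` acting on the form factor. -/
def star₂ (hQ : (eta Q).Nondegenerate) (vol : (CliffordAlgebra Q)ˣ) (e : T ≃ₗ[ℝ] V) :
    Fiber Q T ≃ₗ[ℝ] Fiber Q T :=
  TensorProduct.congr (LinearEquiv.refl ℝ _) (hodgeForms hQ vol e)

/-- `F' = *₂⁻¹ E *₂`. -/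
def opF' (hQ : (eta Q).Nondegenerate) (vol : (CliffordAlgebra Q)ˣ) (e : T ≃ₗ[ℝ] V)
    (θ : Fiber Q T) : Fiber Q T →ₗ[ℝ] Fiber Q T :=
  (star₂ hQ vol e).symm.toLinearMap ∘ₗ opE θ ∘ₗ (star₂ hQ vol e).toLinearMap

/-- `H'`: multiplication by `q - p` on `Cl^p ⊗ Λ^q`. -/
def opH' : Fiber Q T →ₗ[ℝ] Fiber Q T :=
  TensorProduct.map LinearMap.id (numberOp (Module.Dual ℝ T)) -
    TensorProduct.map
      ((CliffordAlgebra.equivExterior Q).symm.toLinearMap ∘ₗ numberOp V ∘ₗ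
        (CliffordAlgebra.equivExterior Q).toLinearMap) LinearMap.id

/-- A Clifford form at a point, viewed in `Λ(V) ⊗ Λ(V)` through `Cl(V) ≃ Λ(V)` and
`Λ(T*) ≃ Λ(V)`. -/
def toTensor (hQ : (eta Q).Nondegenerate) (e : T ≃ₗ[ℝ] V) :
    Fiber Q T ≃ₗ[ℝ] ExteriorAlgebra ℝ V ⊗[ℝ] ExteriorAlgebra ℝ V :=
  TensorProduct.congr (CliffordAlgebra.equivExterior Q) (sharpExt hQ e)

end LinearAlgebra

section Manifold

variable {n : ℕ} {M : Type*} [TopologicalSpace M] [ChartedSpace (EuclideanSpace ℝ (Fin n)) M]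
  {V : Type*} [AddCommGroup V] [Module ℝ V] [FiniteDimensional ℝ V]

/-- Not necessarily smooth Clifford forms on `M`. -/
abbrev Field (n : ℕ) (M : Type*) [TopologicalSpace M]
    [ChartedSpace (EuclideanSpace ℝ (Fin n)) M] (Q : QuadraticForm ℝ V) : Type _ :=
  ∀ x : M, Fiber Q (TangentSpace (𝓡 n) x)

variable {Q : QuadraticForm ℝ V}

/-- The coordinate expression, in the chart at `x`, of a Clifford form on `M`: its pullback
under the inverse of the chart. -/
def inChart (α : Field n M Q) (x : M) (y : EuclideanSpace ℝ (Fin n)) :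
    Fiber Q (EuclideanSpace ℝ (Fin n)) :=
  pullback Q (T := EuclideanSpace ℝ (Fin n))
    (T' := TangentSpace (𝓡 n) ((extChartAt (𝓡 n) x).symm y))
    (mfderiv (𝓡 n) (𝓡 n) (extChartAt (𝓡 n) x).symm y).toLinearMap
    (α ((extChartAt (𝓡 n) x).symm y))

/-- The derivative in direction `v` of a function with values in a finite-dimensional real
vector space, computed coordinatewise in a basis. -/
def dirDeriv {W : Type*} [AddCommGroup W] [Module ℝ W] [FiniteDimensional ℝ W]
    (f : EuclideanSpace ℝ (Fin n) → W) (v y : EuclideanSpace ℝ (Fin n)) : W :=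
  ∑ j, fderiv ℝ (fun z => (Module.finBasis ℝ W).coord j (f z)) y v • Module.finBasis ℝ W j

/-- The Clifford form `dx^i` on Euclidean space. -/
def dx (Q : QuadraticForm ℝ V) (i : Fin n) : Fiber Q (EuclideanSpace ℝ (Fin n)) :=
  1 ⊗ₜ[ℝ] ExteriorAlgebra.ι ℝ ((EuclideanSpace.basisFun (Fin n) ℝ).toBasis.coord i)

/-- The exterior derivative `∑ i, dx^i ∂_i f` on Euclidean space. -/
def dEuclidean (f : EuclideanSpace ℝ (Fin n) → Fiber Q (EuclideanSpace ℝ (Fin n)))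
    (y : EuclideanSpace ℝ (Fin n)) : Fiber Q (EuclideanSpace ℝ (Fin n)) :=
  ∑ i, dx Q i * dirDeriv f (EuclideanSpace.single i 1) y

/-- The exterior derivative of Clifford forms on `M`, computed at `x` in the chart at `x`. -/
def extD (α : Field n M Q) : Field n M Q := fun x =>
  pullback Q (T := TangentSpace (𝓡 n) x) (T' := EuclideanSpace ℝ (Fin n))
    (mfderiv (𝓡 n) (𝓡 n) (extChartAt (𝓡 n) x) x).toLinearMap
    (dEuclidean (inChart α x) (extChartAt (𝓡 n) x x))

/-- `α ∈ Ω^{pq}`: smooth, with values in `Cl^p(V) ⊗ Λ^q(T*M)`. -/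
structure IsForm (α : Field n M Q) (p q : ℕ) : Prop where
  bidegree : ∀ x, α x ∈ bidegree Q (TangentSpace (𝓡 n) x) p q
  smooth : ∀ (x : M) (φ : Module.Dual ℝ (Fiber Q (EuclideanSpace ℝ (Fin n)))),
    ContDiffOn ℝ ((⊤ : ℕ∞) : WithTop ℕ∞) (fun y => φ (inChart α x y)) (extChartAt (𝓡 n) x).target

/-- `θ` induces at every point the isomorphism `e x : X ↦ i_X θ` of the tangent space with `V`. -/
def Induces (θ : Field n M Q) (e : ∀ x : M, TangentSpace (𝓡 n) x ≃ₗ[ℝ] V) : Prop :=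
  ∀ (x : M) (X : TangentSpace (𝓡 n) x), interior X (θ x) = CliffordAlgebra.ι Q (e x X) ⊗ₜ[ℝ] 1

/-- `∇ x = d x + ω x - (-1)^q x ω` for `x` of bidegree `(p, q)`. -/
def covD (ω α : Field n M Q) : Field n M Q := fun x =>
  extD α x + ω x * α x - formSign (α x) * ω x

/-- The torsion `t = d θ + ω θ + θ ω`. -/
def torsion (θ ω : Field n M Q) : Field n M Q := fun x =>
  extD θ x + ω x * θ x + θ x * ω x

/-- The curvature `R = d ω + ω²`. -/
def curvature (ω : Field n M Q) : Field n M Q := fun x =>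
  extD ω x + ω x * ω x

end Manifold

section VolumeElements

open CliffordAlgebra

variable {V : Type*} [AddCommGroup V] [Module ℝ V]

theorem contract_ext (d : Module.Dual ℝ V) (l : List V) (h : ∀ v ∈ l, d v = 0) :
    contractLeft (Q := (0 : QuadraticForm ℝ V)) d ((l.map (ExteriorAlgebra.ι ℝ)).prod) = 0 := by
  induction l with
  | nil => simp [contractLeft_one]
  | cons a l ih =>
    have h1 := ih (fun v hv => h v (List.mem_cons_of_mem _ hv))
    have h2 := h a (List.mem_cons_self ..)
    rw [List.map_cons, List.prod_cons]
    erw [contractLeft_ι_mul, h1, h2]; simp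

theorem equivExterior_prod (Q : QuadraticForm ℝ V) (l : List V)
    (h : l.Pairwise fun v w => eta Q v w = 0) :
    equivExterior Q ((l.map (ι Q)).prod) = (l.map (ExteriorAlgebra.ι ℝ)).prod := by
  induction l with
  | nil => simp [equivExterior]
  | cons a l ih =>
    rw [List.pairwise_cons] at h
    have h1 := ih h.2
    rw [List.map_cons, List.prod_cons, List.map_cons, List.prod_cons]
    simp only [equivExterior, changeFormEquiv_apply] at h1 ⊢
    rw [changeForm_ι_mul, h1, contract_ext _ _ (by intro v hv; simpa using h.1 v hv)]
    simp [ExteriorAlgebra.ι]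

/-- Volume elements exist. -/
theorem exists_vol [FiniteDimensional ℝ V] (Q : QuadraticForm ℝ V)
    (hQ : (eta Q).Nondegenerate) :
    ∃ vol : (CliffordAlgebra Q)ˣ,
      (vol : CliffordAlgebra Q) ∈ clPart Q (Module.finrank ℝ V) := by
  obtain ⟨b, hb⟩ := LinearMap.BilinForm.exists_orthogonal_basis
    (QuadraticForm.associated_isSymm ℝ Q)
  have hb' : ∀ i, IsUnit (ι Q (b i)) := fun i => by
    have := LinearMap.IsOrthoᵢ.not_isOrtho_basis_self_of_separatingLeft hb hQ.1 i
    refine isUnit_ι_of_isUnit _ (isUnit_iff_ne_zero.2 ?_)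
    intro h0
    exact this ((QuadraticMap.associated_eq_self_apply ℝ Q (b i)).trans h0)
  have hu : IsUnit (((List.ofFn b).map (ι Q)).prod) := by
    refine List.prod_isUnit ?_
    simpa using hb'
  refine ⟨hu.unit, ?_⟩
  rw [IsUnit.unit_spec, clPart, Submodule.mem_map]
  refine ⟨((List.ofFn b).map (ExteriorAlgebra.ι ℝ)).prod, ?_, ?_⟩
  · rw [List.map_ofFn]
    exact (ExteriorAlgebra.ιMulti_range ℝ _ ⟨b, ExteriorAlgebra.ιMulti_apply b⟩ :)
  · rw [LinearEquiv.coe_coe, LinearEquiv.symm_apply_eq, equivExterior_prod]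
    rw [List.pairwise_ofFn]
    intro i j hij
    exact hb hij.ne

theorem comm_contract (Q : QuadraticForm ℝ V) (v : V) (a : CliffordAlgebra Q) :
    ι Q v * a - involute a * ι Q v = (2:ℝ) • contractLeft (eta Q v) a := by
  induction a using CliffordAlgebra.left_induction with
  | algebraMap r => simp [contractLeft_algebraMap, Algebra.commutes]
  | add x y hx hy => simp only [map_add, mul_add, add_mul, smul_add, ← hx, ← hy]; abel
  | ι_mul x w h =>
    rw [contractLeft_ι_mul, smul_sub, ← mul_smul_comm, ← h, map_mul, involute_ι]
    have : ι Q v * ι Q w = algebraMap ℝ _ (2 * eta Q v w) - ι Q w * ι Q v := by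
      rw [eq_sub_iff_add_eq, ι_mul_ι_add_swap]
      congr 1
      have := LinearMap.congr_fun (LinearMap.congr_fun (QuadraticMap.two_nsmul_associated ℝ Q) v) w
      rw [LinearMap.smul_apply, LinearMap.smul_apply, two_nsmul] at this
      rw [two_mul]; exact this.symm
    rw [← mul_assoc, this, sub_mul, ← Algebra.smul_def, smul_smul]
    noncomm_ring

/-- The isomorphism `Cl(V) ≃ Λ(V)` turns `v ∧ a` into the exterior product. -/
theorem equivExterior_wedge (Q : QuadraticForm ℝ V) (v : V) (a : CliffordAlgebra Q) :
    equivExterior Q ((1/2:ℝ) • (ι Q v * a + involute a * ι Q v)) =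
      ExteriorAlgebra.ι ℝ v * equivExterior Q a := by
  have h : (1/2:ℝ) • (ι Q v * a + involute a * ι Q v) =
      ι Q v * a - contractLeft (eta Q v) a := by
    have := comm_contract Q v a
    have h2 : involute a * ι Q v = ι Q v * a - (2:ℝ) • contractLeft (eta Q v) a := by
      rw [← this]; abel
    rw [h2]; module
  rw [h, map_sub]
  simp only [equivExterior, changeFormEquiv_apply]
  rw [changeForm_ι_mul, changeForm_contractLeft]
  simp [ExteriorAlgebra.ι]

/-- `v ∧ (*a) = *(v ⊢ a)`. -/
theorem hodge_spec [FiniteDimensional ℝ V] (Q : QuadraticForm ℝ V) (vol : (CliffordAlgebra Q)ˣ)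
    (hvol : (vol : CliffordAlgebra Q) ∈ clPart Q (Module.finrank ℝ V)) (v : V)
    (a : CliffordAlgebra Q) :
    (1/2:ℝ) • (ι Q v * hodge vol a + involute (hodge vol a) * ι Q v) =
      hodge vol ((1/2:ℝ) • (ι Q v * a - involute a * ι Q v)) := by
  have key : ι Q v * (vol : CliffordAlgebra Q) + involute (vol : CliffordAlgebra Q) * ι Q v = 0 := by
    have h := equivExterior_wedge Q v vol
    obtain ⟨y, hy, hyv⟩ := hvol
    have h0 : ExteriorAlgebra.ι ℝ v * y = 0 := by
      have : ExteriorAlgebra.ι ℝ v * y ∈ ⋀[ℝ]^(1 + Module.finrank ℝ V) V :=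
        SetLike.mul_mem_graded (A := fun i : ℕ => ⋀[ℝ]^i V) (by simp) hy
      have hz : Module.finrank ℝ (⋀[ℝ]^(1 + Module.finrank ℝ V) V) = 0 := by
        rw [exteriorPower.finrank_eq]; exact Nat.choose_eq_zero_of_lt (by omega)
      rw [Submodule.finrank_eq_zero] at hz
      rw [hz] at this; simpa using this
    rw [← hyv] at h ⊢
    simp only [LinearEquiv.coe_coe, LinearEquiv.apply_symm_apply, h0] at h ⊢
    have := (LinearEquiv.map_eq_zero_iff _).1 h
    exact (smul_eq_zero.1 this).resolve_left (by norm_num)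
  have e1 : ∀ z, hodge vol z = z * vol := fun z => rfl
  simp only [e1, map_mul]
  rw [smul_mul_assoc, sub_mul]
  congr 1
  have k2 : involute (vol : CliffordAlgebra Q) * ι Q v = - (ι Q v * vol) := by
    rw [eq_neg_iff_add_eq_zero, add_comm]; exact key
  rw [mul_assoc (involute a), k2]
  noncomm_ring
end VolumeElements

end CliffordForms

end

/-! The identity for `∇t` is the graded Leibniz rule together with `d² = 0`. Differentiating `t = dθ
+ ωθ + θω` gives `dω θ - ω dθ + dθ ω - θ dω`, and adding `ωt - tω` cancels every term containing
`dθ` as well as `ωθω`, which leaves `Rθ - θR` (`extD_torsion_add_commutator`).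

To recognise this as `-2E'R`, write `θ = Σ bᵢ ⊗ βᵢ` in a frame (`eq_sum_frame`). Then `E = Σ (bᵢ ∧)
⊗ (βᵢ ∧)`, and conjugation by `*₁` turns the Clifford wedge into the contraction `v ⊢ a`. On `Cl²`
this contraction is half of a commutator, while `βᵢ` commutes with 2-forms (`neg_two_smul_opE'`).

If `t = 0` everywhere, then `∇t = 0` and so `E'R = 0`. Inside `Λ(V) ⊗ Λ(V)` this is the first
Bianchi identity: contracting one slot of the first factor and wedging it onto the second gives
zero. Evaluated on four covectors it is the cyclic identity (`pairing₄_bianchi`), and with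
antisymmetry inside each pair it yields the pair symmetry of `R` (`pairing₄_symm`,
`comm_eq_self_of_bianchi`). The exchange of factors carries `E'` to `F'`, so the symmetry of `R`
gives `F'R = 0`. Finally `H'R = 0` because `p = q = 2`.

The analytic part makes `d` usable on `M`. In Euclidean space it satisfies Leibniz, `d² = 0` and
naturality under pullback (`dEuclidean_pullback`). Naturality shows that `extD`, defined at each
point in its own chart, may be computed in any one chart (`extD_eq_pullback`), so these rules
transfer to `M`. -/

namespace CliffordForms

/-! ### Wedge and contraction in `Cl(V)`, commutators with `Cl²`, bidegrees, signs and pullbacks. -/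

section PointwiseAlgebra

open CliffordAlgebra

variable {V : Type*} [AddCommGroup V] [Module ℝ V] {Q : QuadraticForm ℝ V}
  {T : Type*} [AddCommGroup T] [Module ℝ T]

/-- The operator `v ∧ a = (v a + (-1)^{deg a} a v) / 2` on the Clifford algebra. -/
noncomputable def clWedge (Q : QuadraticForm ℝ V) (v : V) :
    CliffordAlgebra Q →ₗ[ℝ] CliffordAlgebra Q :=
  (1 / 2 : ℝ) • (LinearMap.mulLeft ℝ (ι Q v) +
    LinearMap.mulRight ℝ (ι Q v) ∘ₗ involute.toLinearMap)

/-- The operator `v ⊢ a = (v a - (-1)^{deg a} a v) / 2` on the Clifford algebra. -/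
noncomputable def clContract (Q : QuadraticForm ℝ V) (v : V) :
    CliffordAlgebra Q →ₗ[ℝ] CliffordAlgebra Q :=
  (1 / 2 : ℝ) • (LinearMap.mulLeft ℝ (ι Q v) -
    LinearMap.mulRight ℝ (ι Q v) ∘ₗ involute.toLinearMap)

theorem clWedge_apply (v : V) (a : CliffordAlgebra Q) :
    clWedge Q v a = (1 / 2 : ℝ) • (ι Q v * a + involute a * ι Q v) := rfl

theorem clContract_apply (v : V) (a : CliffordAlgebra Q) :
    clContract Q v a = (1 / 2 : ℝ) • (ι Q v * a - involute a * ι Q v) := rfl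

theorem equivExterior_clWedge (v : V) (a : CliffordAlgebra Q) :
    equivExterior Q (clWedge Q v a) = ExteriorAlgebra.ι ℝ v * equivExterior Q a := by
  rw [clWedge_apply, equivExterior_wedge]

theorem equivExterior_clContract (v : V) (a : CliffordAlgebra Q) :
    equivExterior Q (clContract Q v a) =
      contractLeft (Q := (0 : QuadraticForm ℝ V)) (eta Q v) (equivExterior Q a) := by
  rw [clContract_apply, comm_contract, smul_smul, one_div, inv_mul_cancel₀ two_ne_zero, one_smul]
  simp only [equivExterior, changeFormEquiv_apply]
  rw [changeForm_contractLeft]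

theorem equivExterior_symm_ι_mul (v : V) (x : ExteriorAlgebra ℝ V) :
    (equivExterior Q).symm (ExteriorAlgebra.ι ℝ v * x) =
      clWedge Q v ((equivExterior Q).symm x) := by
  rw [LinearEquiv.symm_apply_eq, equivExterior_clWedge, LinearEquiv.apply_symm_apply]

theorem equivExterior_symm_one : (equivExterior Q).symm (1 : ExteriorAlgebra ℝ V) = 1 := by
  simp [equivExterior]

theorem equivExterior_symm_ι (v : V) :
    (equivExterior Q).symm (ExteriorAlgebra.ι ℝ v) = ι Q v := by
  rw [← mul_one (ExteriorAlgebra.ι ℝ v), equivExterior_symm_ι_mul, equivExterior_symm_one,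
    clWedge_apply, map_one, mul_one, one_mul, ← two_smul ℝ, smul_smul]
  norm_num

/-- This is where the star enters: `hodge_spec` read as a conjugation, the source of the formulas
for both `E'` and `F'`. -/
theorem hodge_symm_clWedge [FiniteDimensional ℝ V] (vol : (CliffordAlgebra Q)ˣ)
    (hvol : (vol : CliffordAlgebra Q) ∈ clPart Q (Module.finrank ℝ V)) (v : V)
    (a : CliffordAlgebra Q) :
    (hodge vol).symm (clWedge Q v (hodge vol a)) = clContract Q v a := by
  rw [LinearEquiv.symm_apply_eq, clWedge_apply, hodge_spec Q vol hvol, clContract_apply]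

theorem clPart_one_iff {a : CliffordAlgebra Q} : a ∈ clPart Q 1 ↔ ∃ v, ι Q v = a := by
  rw [clPart, ExteriorAlgebra.exteriorPower, pow_one, Submodule.mem_map]
  constructor
  · rintro ⟨_, ⟨v, rfl⟩, rfl⟩
    exact ⟨v, (equivExterior_symm_ι v).symm⟩
  · rintro ⟨v, rfl⟩
    exact ⟨_, ⟨v, rfl⟩, equivExterior_symm_ι v⟩

theorem equivExterior_symm_ι_mul_ι (v w : V) :
    (equivExterior Q).symm (ExteriorAlgebra.ι ℝ v * ExteriorAlgebra.ι ℝ w) =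
      (1 / 2 : ℝ) • (ι Q v * ι Q w - ι Q w * ι Q v) := by
  rw [equivExterior_symm_ι_mul, equivExterior_symm_ι, clWedge_apply, involute_ι]
  congr 1
  noncomm_ring

theorem exteriorPower_two_eq_span (W : Type*) [AddCommGroup W] [Module ℝ W] :
    ⋀[ℝ]^2 W = Submodule.span ℝ
      {x | ∃ v w : W, ExteriorAlgebra.ι ℝ v * ExteriorAlgebra.ι ℝ w = x} := by
  rw [ExteriorAlgebra.exteriorPower, pow_two]
  apply le_antisymm
  · rw [Submodule.mul_le]
    rintro _ ⟨v, rfl⟩ _ ⟨w, rfl⟩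
    exact Submodule.subset_span ⟨v, w, rfl⟩
  · rw [Submodule.span_le]
    rintro _ ⟨v, w, rfl⟩
    exact Submodule.mul_mem_mul ⟨v, rfl⟩ ⟨w, rfl⟩

theorem clPart_two_eq_span : clPart Q 2 = Submodule.span ℝ
    {x | ∃ v w : V, (1 / 2 : ℝ) • (ι Q v * ι Q w - ι Q w * ι Q v) = x} := by
  rw [clPart, exteriorPower_two_eq_span, Submodule.map_span]
  congr 1
  ext x
  constructor
  · rintro ⟨_, ⟨v, w, rfl⟩, rfl⟩
    exact ⟨v, w, (equivExterior_symm_ι_mul_ι v w).symm⟩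
  · rintro ⟨v, w, rfl⟩
    exact ⟨_, ⟨v, w, rfl⟩, equivExterior_symm_ι_mul_ι v w⟩

theorem involute_clPart_two {a : CliffordAlgebra Q} (ha : a ∈ clPart Q 2) : involute a = a := by
  rw [clPart_two_eq_span] at ha
  induction ha using Submodule.span_induction with
  | mem x h => obtain ⟨v, w, rfl⟩ := h; simp
  | zero => simp
  | add x y _ _ hx hy => simp [hx, hy]
  | smul r x _ hx => simp [hx]

theorem ι_mul_ι_eq (v w : V) :
    ι Q v * ι Q w = algebraMap ℝ _ (2 * eta Q v w) - ι Q w * ι Q v := by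
  rw [eq_sub_iff_add_eq, ι_mul_ι_add_swap]
  congr 1
  have := LinearMap.congr_fun (LinearMap.congr_fun (QuadraticMap.two_nsmul_associated ℝ Q) v) w
  rw [LinearMap.smul_apply, LinearMap.smul_apply, two_nsmul] at this
  rw [two_mul]; exact this.symm

/-- Elements of `Cl^2(V)` act on `V` by commutators. -/
theorem commutator_clPart_two {a : CliffordAlgebra Q} (ha : a ∈ clPart Q 2) (u : V) :
    ∃ u', a * ι Q u - ι Q u * a = ι Q u' := by
  rw [clPart_two_eq_span] at ha
  induction ha using Submodule.span_induction with
  | mem x h =>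
    obtain ⟨v, w, rfl⟩ := h
    -- The witness comes from moving `u` through `v w` and through `w v` by the Clifford relation;
    -- each transposition leaves a scalar times a vector, and the two halves add up.
    refine ⟨(2 * eta Q w u) • v - (2 * eta Q u v) • w, ?_⟩
    have h1 := ι_mul_ι_eq (Q := Q) w u
    have h2 := ι_mul_ι_eq (Q := Q) u v
    have h3 : ∀ r : ℝ, ∀ x : CliffordAlgebra Q, algebraMap ℝ _ r * x = x * algebraMap ℝ _ r :=
      fun r x => Algebra.commutes r x
    have e1 : ι Q v * ι Q w * ι Q u - ι Q u * (ι Q v * ι Q w) =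
        ι Q v * algebraMap ℝ _ (2 * eta Q w u) - algebraMap ℝ _ (2 * eta Q u v) * ι Q w := by
      rw [mul_assoc, h1, ← mul_assoc (ι Q u), h2]
      noncomm_ring
    have h4 := ι_mul_ι_eq (Q := Q) v u
    have h5 := ι_mul_ι_eq (Q := Q) u w
    have e2 : ι Q w * ι Q v * ι Q u - ι Q u * (ι Q w * ι Q v) =
        ι Q w * algebraMap ℝ _ (2 * eta Q v u) - algebraMap ℝ _ (2 * eta Q u w) * ι Q v := by
      rw [mul_assoc, h4, ← mul_assoc (ι Q u), h5]
      noncomm_ring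
    have s1 : eta Q v u = eta Q u v := (QuadraticForm.associated_isSymm ℝ Q).eq _ _
    have s2 : eta Q w u = eta Q u w := (QuadraticForm.associated_isSymm ℝ Q).eq _ _
    rw [smul_mul_assoc, mul_smul_comm, ← smul_sub, sub_mul, mul_sub,
      show ∀ a b c d : CliffordAlgebra Q, a - b - (c - d) = (a - c) - (b - d) by
        intros; abel, e1, e2, s1, s2, map_sub, map_smul, map_smul,
      ← h3 _ (ι Q v), ← h3 _ (ι Q w)]
    simp only [← Algebra.smul_def]
    module
  | zero => exact ⟨0, by simp⟩
  | add x y _ _ hx hy =>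
    obtain ⟨x', hx⟩ := hx
    obtain ⟨y', hy⟩ := hy
    exact ⟨x' + y', by rw [map_add, ← hx, ← hy]; noncomm_ring⟩
  | smul r x _ hx =>
    obtain ⟨x', hx⟩ := hx
    exact ⟨r • x', by rw [map_smul, ← hx, smul_sub, smul_mul_assoc, mul_smul_comm]⟩

/-- The commutator with `a` is a derivation that preserves `V`, hence it preserves the span of the
elements `½(vw - wv)`. -/
theorem commutator_clPart_two_two {a b : CliffordAlgebra Q} (ha : a ∈ clPart Q 2)
    (hb : b ∈ clPart Q 2) : a * b - b * a ∈ clPart Q 2 := by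
  have hb' := hb
  rw [clPart_two_eq_span] at hb'
  induction hb' using Submodule.span_induction with
  | mem x h =>
    obtain ⟨v, w, rfl⟩ := h
    obtain ⟨v', hv⟩ := commutator_clPart_two ha v
    obtain ⟨w', hw⟩ := commutator_clPart_two ha w
    have key : a * ((1 / 2 : ℝ) • (ι Q v * ι Q w - ι Q w * ι Q v)) -
        ((1 / 2 : ℝ) • (ι Q v * ι Q w - ι Q w * ι Q v)) * a =
        (1 / 2 : ℝ) • (ι Q v' * ι Q w - ι Q w * ι Q v') +
        (1 / 2 : ℝ) • (ι Q v * ι Q w' - ι Q w' * ι Q v) := by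
      rw [← hv, ← hw, mul_smul_comm, smul_mul_assoc, ← smul_sub, ← smul_add]
      congr 1
      noncomm_ring
    rw [key, clPart_two_eq_span]
    exact add_mem (Submodule.subset_span ⟨_, _, rfl⟩) (Submodule.subset_span ⟨_, _, rfl⟩)
  | zero => simp
  | add x y hx' hy' hx hy =>
    rw [← clPart_two_eq_span] at hx' hy'
    have := add_mem (hx hx') (hy hy')
    convert this using 1
    noncomm_ring
  | smul r x hx' hx =>
    rw [← clPart_two_eq_span] at hx'
    have := Submodule.smul_mem _ r (hx hx')
    rwa [smul_sub, ← mul_smul_comm, ← smul_mul_assoc r x a] at this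

theorem bidegree_eq_span (p q : ℕ) : bidegree Q T p q = Submodule.span ℝ
    {x | ∃ a ∈ clPart Q p, ∃ α ∈ ⋀[ℝ]^q (Module.Dual ℝ T), a ⊗ₜ[ℝ] α = x} := by
  rw [bidegree, TensorProduct.range_map_eq_span_tmul]
  congr 1
  ext x
  constructor
  · rintro ⟨a, α, rfl⟩
    exact ⟨a, a.2, α, α.2, rfl⟩
  · rintro ⟨a, ha, α, hα, rfl⟩
    exact ⟨⟨a, ha⟩, ⟨α, hα⟩, rfl⟩

theorem tmul_mem_bidegree {p q : ℕ} {a : CliffordAlgebra Q} (ha : a ∈ clPart Q p)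
    {α : ExteriorAlgebra ℝ (Module.Dual ℝ T)} (hα : α ∈ ⋀[ℝ]^q (Module.Dual ℝ T)) :
    a ⊗ₜ[ℝ] α ∈ bidegree Q T p q := by
  rw [bidegree_eq_span]
  exact Submodule.subset_span ⟨a, ha, α, hα, rfl⟩

/-- Reduction to pure tensors. With `S = ⊥`, applied to a difference of two maps, it also proves
identities of operators on a fixed bidegree. -/
theorem map_mem_of_mem_bidegree {W : Type*} [AddCommGroup W] [Module ℝ W]
    {p q : ℕ} (S : Submodule ℝ W)
    (B : Fiber Q T →ₗ[ℝ] W)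
    (h : ∀ a ∈ clPart Q p, ∀ α ∈ ⋀[ℝ]^q (Module.Dual ℝ T), B (a ⊗ₜ α) ∈ S)
    {x : Fiber Q T} (hx : x ∈ bidegree Q T p q) : B x ∈ S := by
  rw [bidegree_eq_span] at hx
  have : Submodule.span ℝ {x : Fiber Q T | ∃ a ∈ clPart Q p,
      ∃ α ∈ ⋀[ℝ]^q (Module.Dual ℝ T), a ⊗ₜ[ℝ] α = x} ≤ S.comap B := by
    rw [Submodule.span_le]
    rintro _ ⟨a, ha, α, hα, rfl⟩
    exact h a ha α hα
  exact this hx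

theorem map_mem_of_mem_bidegree₂ {W : Type*} [AddCommGroup W] [Module ℝ W]
    {p q p' q' : ℕ} (S : Submodule ℝ W)
    (B : Fiber Q T →ₗ[ℝ] Fiber Q T →ₗ[ℝ] W)
    (h : ∀ a ∈ clPart Q p, ∀ α ∈ ⋀[ℝ]^q (Module.Dual ℝ T),
      ∀ b ∈ clPart Q p', ∀ β ∈ ⋀[ℝ]^q' (Module.Dual ℝ T), B (a ⊗ₜ α) (b ⊗ₜ β) ∈ S)
    {x y : Fiber Q T} (hx : x ∈ bidegree Q T p q) (hy : y ∈ bidegree Q T p' q') : B x y ∈ S := by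
  refine map_mem_of_mem_bidegree S (B.flip y) ?_ hx
  intro a ha α hα
  exact map_mem_of_mem_bidegree S (B (a ⊗ₜ α)) (h a ha α hα) hy

theorem ι_mul_ι_anticomm {W : Type*} [AddCommGroup W] [Module ℝ W] (d d' : W) :
    ExteriorAlgebra.ι ℝ d' * ExteriorAlgebra.ι ℝ d =
      -(ExteriorAlgebra.ι ℝ d * ExteriorAlgebra.ι ℝ d') := by
  rw [eq_neg_iff_add_eq_zero, ExteriorAlgebra.ι_add_mul_swap]

/-- One-forms anticommute, so on pure tensors the symmetrised product is a commutator in the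
Clifford factor, which maps `Cl² × Cl¹` to `Cl¹`. -/
theorem mul_add_mul_mem_bidegree_one_two {x y : Fiber Q T} (hx : x ∈ bidegree Q T 2 1)
    (hy : y ∈ bidegree Q T 1 1) : x * y + y * x ∈ bidegree Q T 1 2 := by
  refine map_mem_of_mem_bidegree₂ _ (LinearMap.mul ℝ _ + (LinearMap.mul ℝ _).flip) ?_ hx hy
  intro a ha α hα b hb β hβ
  rw [ExteriorAlgebra.exteriorPower, pow_one] at hα hβ
  obtain ⟨d, rfl⟩ := hα
  obtain ⟨d', rfl⟩ := hβ
  obtain ⟨v, rfl⟩ := clPart_one_iff.1 hb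
  obtain ⟨u, hu⟩ := commutator_clPart_two ha v
  simp only [LinearMap.add_apply, LinearMap.mul_apply', LinearMap.flip_apply,
    Algebra.TensorProduct.tmul_mul_tmul]
  rw [ι_mul_ι_anticomm d d', TensorProduct.tmul_neg, ← sub_eq_add_neg, ← TensorProduct.sub_tmul,
    hu]
  refine tmul_mem_bidegree (clPart_one_iff.2 ⟨u, rfl⟩) ?_
  rw [exteriorPower_two_eq_span]
  exact Submodule.subset_span ⟨_, _, rfl⟩

theorem mul_self_mem_bidegree_two_two {x : Fiber Q T} (hx : x ∈ bidegree Q T 2 1) :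
    x * x ∈ bidegree Q T 2 2 := by
  -- The square is not linear in `x`, and on pure tensors `ab` need not lie in `Cl²`. The polarised
  -- form `xy + yx` is bilinear and produces commutators; its value at `(x, x)` is halved at the
  -- end.
  have : x * x + x * x ∈ bidegree Q T 2 2 := by
    refine map_mem_of_mem_bidegree₂ _ (LinearMap.mul ℝ _ + (LinearMap.mul ℝ _).flip) ?_ hx hx
    intro a ha α hα b hb β hβ
    rw [ExteriorAlgebra.exteriorPower, pow_one] at hα hβ
    obtain ⟨d, rfl⟩ := hα
    obtain ⟨d', rfl⟩ := hβ
    simp only [LinearMap.add_apply, LinearMap.mul_apply', LinearMap.flip_apply,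
      Algebra.TensorProduct.tmul_mul_tmul]
    rw [ι_mul_ι_anticomm d d', TensorProduct.tmul_neg, ← sub_eq_add_neg,
      ← TensorProduct.sub_tmul]
    refine tmul_mem_bidegree (commutator_clPart_two_two ha hb) ?_
    rw [exteriorPower_two_eq_span]
    exact Submodule.subset_span ⟨_, _, rfl⟩
  have h := Submodule.smul_mem _ (1 / 2 : ℝ) this
  rwa [← two_smul ℝ (x * x), smul_smul, one_div, inv_mul_cancel₀ two_ne_zero, one_smul] at h

theorem formSign_tmul (a : CliffordAlgebra Q) (α : ExteriorAlgebra ℝ (Module.Dual ℝ T)) :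
    formSign (a ⊗ₜ[ℝ] α : Fiber Q T) = a ⊗ₜ involute α := rfl

theorem involute_mem_exteriorPower {W : Type*} [AddCommGroup W] [Module ℝ W] {q : ℕ}
    {α : ExteriorAlgebra ℝ W} (hα : α ∈ ⋀[ℝ]^q W) :
    involute (Q := (0 : QuadraticForm ℝ W)) α = (-1 : ℝ) ^ q • α := by
  rw [ExteriorAlgebra.exteriorPower] at hα
  induction q generalizing α with
  | zero =>
    rw [pow_zero] at hα
    obtain ⟨r, rfl⟩ := Submodule.mem_one.1 hα
    rw [pow_zero, one_smul]
    exact involute.commutes r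
  | succ q ih =>
    rw [pow_succ] at hα
    induction hα using Submodule.mul_induction_on' with
    | mem_mul_mem x hx y hy =>
      obtain ⟨v, rfl⟩ := hy
      erw [map_mul, ih hx, involute_ι]
      rw [pow_succ]
      erw [mul_neg, smul_mul_assoc]
      simp
    | add x _ y _ hx hy => erw [map_add, hx, hy, smul_add]

theorem formSign_of_mem_bidegree {p q : ℕ} {x : Fiber Q T} (hx : x ∈ bidegree Q T p q) :
    formSign x = (-1 : ℝ) ^ q • x := by
  have := map_mem_of_mem_bidegree ⊥ (formSign - (-1 : ℝ) ^ q • LinearMap.id) ?_ hx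
  · simpa [sub_eq_zero] using this
  · intro a ha α hα
    simp only [LinearMap.sub_apply, formSign_tmul, LinearMap.smul_apply, LinearMap.id_apply,
      Submodule.mem_bot]
    rw [involute_mem_exteriorPower hα, TensorProduct.tmul_smul, sub_self]

/-- The exterior algebra is the Clifford algebra of the zero form, for which the contraction term of
`comm_contract` vanishes. -/
theorem involute_mul_ι {W : Type*} [AddCommGroup W] [Module ℝ W] (d : W)
    (α : ExteriorAlgebra ℝ W) :
    involute (Q := (0 : QuadraticForm ℝ W)) α * ExteriorAlgebra.ι ℝ d =
      ExteriorAlgebra.ι ℝ d * α := by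
  have := comm_contract (0 : QuadraticForm ℝ W) d α
  have h0 : eta (0 : QuadraticForm ℝ W) d = 0 := by
    ext w; simp [eta]
  rw [h0] at this
  simp only [map_zero, LinearMap.zero_apply, smul_zero, sub_eq_zero] at this
  exact this.symm

theorem one_tmul_ι_mul (d : Module.Dual ℝ T) (x : Fiber Q T) :
    (1 ⊗ₜ[ℝ] ExteriorAlgebra.ι ℝ d) * x = formSign x * (1 ⊗ₜ[ℝ] ExteriorAlgebra.ι ℝ d) := by
  induction x using TensorProduct.induction_on with
  | zero => simp
  | add x x' hx hx' => simp only [mul_add, map_add, hx, hx', add_mul]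
  | tmul a α =>
    rw [formSign_tmul, Algebra.TensorProduct.tmul_mul_tmul, Algebra.TensorProduct.tmul_mul_tmul,
      one_mul, mul_one]
    congr 1
    exact (involute_mul_ι d α).symm

theorem one_tmul_ι_mul_mem_bidegree {p q : ℕ} (d : Module.Dual ℝ T) {x : Fiber Q T}
    (hx : x ∈ bidegree Q T p q) :
    (1 ⊗ₜ[ℝ] ExteriorAlgebra.ι ℝ d) * x ∈ bidegree Q T p (q + 1) := by
  refine map_mem_of_mem_bidegree _ (LinearMap.mulLeft ℝ (1 ⊗ₜ[ℝ] ExteriorAlgebra.ι ℝ d)) ?_ hx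
  intro a ha α hα
  rw [LinearMap.mulLeft_apply, Algebra.TensorProduct.tmul_mul_tmul, one_mul]
  refine tmul_mem_bidegree ha ?_
  rw [ExteriorAlgebra.exteriorPower, pow_succ']
  exact Submodule.mul_mem_mul ⟨d, rfl⟩ hα

variable {T' T'' : Type*} [AddCommGroup T'] [Module ℝ T'] [AddCommGroup T''] [Module ℝ T'']

theorem pullback_tmul (L : T →ₗ[ℝ] T') (a : CliffordAlgebra Q)
    (α : ExteriorAlgebra ℝ (Module.Dual ℝ T')) :
    pullback Q L (a ⊗ₜ α) = a ⊗ₜ ExteriorAlgebra.map L.dualMap α := rfl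

theorem pullback_id (x : Fiber Q T) : pullback Q (LinearMap.id : T →ₗ[ℝ] T) x = x := by
  have : pullback Q (LinearMap.id : T →ₗ[ℝ] T) = AlgHom.id ℝ _ := by
    rw [pullback, LinearMap.dualMap_id, ExteriorAlgebra.map_id, Algebra.TensorProduct.map_id]
  rw [this, AlgHom.id_apply]

theorem pullback_pullback (L : T →ₗ[ℝ] T') (L' : T' →ₗ[ℝ] T'') (x : Fiber Q T'') :
    pullback Q L (pullback Q L' x) = pullback Q (L' ∘ₗ L) x := by
  induction x using TensorProduct.induction_on with
  | zero => simp
  | add x x' hx hx' => simp only [map_add, hx, hx']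
  | tmul a α =>
    rw [pullback_tmul, pullback_tmul, pullback_tmul, ← AlgHom.comp_apply,
      ExteriorAlgebra.map_comp_map, LinearMap.dualMap_comp_dualMap]

theorem pullback_mem_bidegree (L : T →ₗ[ℝ] T') {p q : ℕ} {x : Fiber Q T'}
    (hx : x ∈ bidegree Q T' p q) : pullback Q L x ∈ bidegree Q T p q := by
  refine map_mem_of_mem_bidegree _ (pullback Q L).toLinearMap ?_ hx
  intro a ha α hα
  refine tmul_mem_bidegree ha ?_
  have := Submodule.mem_map_of_mem (f := (ExteriorAlgebra.map L.dualMap).toLinearMap) hα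
  rw [ExteriorAlgebra.exteriorPower, Submodule.map_pow] at this
  refine (pow_le_pow_left' (?_ : Submodule.map _ _ ≤ _) q) this
  rintro _ ⟨_, ⟨d, rfl⟩, rfl⟩
  exact ⟨_, (ExteriorAlgebra.map_apply_ι _ _).symm⟩

theorem pullback_formSign (L : T →ₗ[ℝ] T') (x : Fiber Q T') :
    pullback Q L (formSign x) = formSign (pullback Q L x) := by
  induction x using TensorProduct.induction_on with
  | zero => simp
  | add x x' hx hx' => simp only [map_add, hx, hx']
  | tmul a α =>
    rw [formSign_tmul, pullback_tmul, pullback_tmul, formSign_tmul]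
    congr 1
    -- Both composites are algebra homomorphisms that send a generator to minus its image.
    have : (ExteriorAlgebra.map L.dualMap).comp
        (involute (Q := (0 : QuadraticForm ℝ (Module.Dual ℝ T')))) =
        (involute (Q := (0 : QuadraticForm ℝ (Module.Dual ℝ T)))).comp
          (ExteriorAlgebra.map L.dualMap) := by
      apply ExteriorAlgebra.hom_ext
      ext d
      simp only [AlgHom.comp_toLinearMap, LinearMap.comp_apply, AlgHom.toLinearMap_apply]
      erw [involute_ι, map_neg, ExteriorAlgebra.map_apply_ι, involute_ι]
    exact DFunLike.congr_fun this α

end PointwiseAlgebra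
-- Frame formulas for `E`, `E'`, `F'` and `H'`.
section Operators

open CliffordAlgebra

variable {V : Type*} [AddCommGroup V] [Module ℝ V] {Q : QuadraticForm ℝ V}
  {T : Type*} [AddCommGroup T] [Module ℝ T]

theorem interior_tmul_ι (X : T) (a : CliffordAlgebra Q) (d : Module.Dual ℝ T) :
    interior X (a ⊗ₜ[ℝ] ExteriorAlgebra.ι ℝ d : Fiber Q T) = (d X • a) ⊗ₜ 1 := by
  have : interior X (a ⊗ₜ[ℝ] ExteriorAlgebra.ι ℝ d : Fiber Q T) =
    a ⊗ₜ contractLeft (Q := (0 : QuadraticForm ℝ (Module.Dual ℝ T)))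
      (Module.Dual.eval ℝ T X) (ExteriorAlgebra.ι ℝ d) := rfl
  rw [this]
  erw [contractLeft_ι]
  rw [Module.Dual.eval_apply, Algebra.algebraMap_eq_smul_one, TensorProduct.tmul_smul,
    ← TensorProduct.smul_tmul']

theorem eq_sum_interior {κ : Type*} [Fintype κ] (B : Module.Basis κ ℝ T) {x : Fiber Q T}
    (hx : x ∈ bidegree Q T 1 1) :
    x = ∑ i, interior (B i) x * (1 ⊗ₜ[ℝ] ExteriorAlgebra.ι ℝ (B.coord i)) := by
  have := map_mem_of_mem_bidegree ⊥ (LinearMap.id - ∑ i,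
    LinearMap.mulRight ℝ (1 ⊗ₜ[ℝ] ExteriorAlgebra.ι ℝ (B.coord i)) ∘ₗ interior (B i)) ?_ hx
  · simpa [sub_eq_zero] using this
  · intro a ha α hα
    rw [ExteriorAlgebra.exteriorPower, pow_one] at hα
    obtain ⟨d, rfl⟩ := hα
    have hd : d = ∑ i, d (B i) • B.coord i := by
      refine B.ext fun j => ?_
      simp
    simp only [LinearMap.sub_apply, LinearMap.sum_apply, LinearMap.comp_apply, LinearMap.id_apply,
      LinearMap.mulRight_apply, interior_tmul_ι, Algebra.TensorProduct.tmul_mul_tmul, one_mul,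
      mul_one, Submodule.mem_bot, sub_eq_zero]
    conv_lhs => rw [hd, map_sum, TensorProduct.tmul_sum]
    refine Finset.sum_congr rfl fun i _ => ?_
    rw [map_smul, TensorProduct.tmul_smul, TensorProduct.smul_tmul']

/-- A soldering form, written in a frame. -/
theorem eq_sum_frame {κ : Type*} [Fintype κ] (b : Module.Basis κ ℝ V) {x : Fiber Q T}
    (hx : x ∈ bidegree Q T 1 1) (e : T ≃ₗ[ℝ] V)
    (he : ∀ X : T, interior X x = ι Q (e X) ⊗ₜ[ℝ] 1) :
    x = ∑ i, ι Q (b i) ⊗ₜ[ℝ] ExteriorAlgebra.ι ℝ (e.dualMap (b.coord i)) := by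
  conv_lhs => rw [eq_sum_interior (b.map e.symm) hx]
  refine Finset.sum_congr rfl fun i _ => ?_
  rw [he, Algebra.TensorProduct.tmul_mul_tmul, mul_one, one_mul]
  simp
  congr 1

theorem opE_apply (θ x : Fiber Q T) :
    opE θ x = (1 / 2 : ℝ) • (θ * x + totalSign x * θ) := rfl

theorem totalSign_tmul (a : CliffordAlgebra Q) (α : ExteriorAlgebra ℝ (Module.Dual ℝ T)) :
    totalSign (a ⊗ₜ[ℝ] α : Fiber Q T) = involute a ⊗ₜ involute α := rfl

theorem opE_sum {κ : Type*} [Fintype κ] (θ : κ → Fiber Q T) (x : Fiber Q T) :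
    opE (∑ i, θ i) x = ∑ i, opE (θ i) x := by
  simp only [opE_apply, Finset.sum_mul, Finset.mul_sum, Finset.smul_sum, smul_add,
    Finset.sum_add_distrib]

/-- The form part of the sign `(-1)^(p+q)` is exactly what moves `d` to the left of `α`; the
Clifford part is left to form `clWedge`. -/
theorem opE_tmul_ι (v : V) (d : Module.Dual ℝ T) :
    opE (ι Q v ⊗ₜ[ℝ] ExteriorAlgebra.ι ℝ d : Fiber Q T) =
      TensorProduct.map (clWedge Q v) (LinearMap.mulLeft ℝ (ExteriorAlgebra.ι ℝ d)) := by
  refine TensorProduct.ext' fun a α => ?_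
  rw [TensorProduct.map_tmul, LinearMap.mulLeft_apply]
  rw [opE_apply, totalSign_tmul, Algebra.TensorProduct.tmul_mul_tmul,
    Algebra.TensorProduct.tmul_mul_tmul, involute_mul_ι, ← TensorProduct.add_tmul,
    TensorProduct.smul_tmul', clWedge_apply]

theorem opE_sum_tmul_ι {κ : Type*} [Fintype κ] (v : κ → V) (d : κ → Module.Dual ℝ T) :
    opE (∑ i, ι Q (v i) ⊗ₜ[ℝ] ExteriorAlgebra.ι ℝ (d i) : Fiber Q T) =
      ∑ i, TensorProduct.map (clWedge Q (v i))
        (LinearMap.mulLeft ℝ (ExteriorAlgebra.ι ℝ (d i))) := by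
  refine LinearMap.ext fun x => ?_
  rw [opE_sum, LinearMap.sum_apply]
  exact Finset.sum_congr rfl fun i _ => by rw [opE_tmul_ι]

theorem numberOp_of_mem {W : Type*} [AddCommGroup W] [Module ℝ W] {p : ℕ}
    {α : ExteriorAlgebra ℝ W} (hα : α ∈ ⋀[ℝ]^p W) : numberOp W α = (p : ℝ) • α := by
  rw [numberOp, LinearMap.comp_apply, LinearEquiv.coe_coe, DirectSum.decomposeLinearEquiv_apply,
    DirectSum.decompose_of_mem (fun p : ℕ => ⋀[ℝ]^p W) hα]
  erw [DirectSum.toModule_lof]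
  rfl

theorem opH'_of_mem_bidegree {p q : ℕ} {x : Fiber Q T} (hx : x ∈ bidegree Q T p q) :
    opH' x = ((q : ℝ) - p) • x := by
  have := map_mem_of_mem_bidegree ⊥ (opH' - ((q : ℝ) - p) • LinearMap.id) ?_ hx
  · exact sub_eq_zero.1 ((Submodule.mem_bot ℝ).1 this)
  · rintro _ ⟨a, ha, rfl⟩ α hα
    simp only [opH', LinearMap.sub_apply, LinearMap.smul_apply, TensorProduct.map_tmul,
      LinearMap.id_apply, Submodule.mem_bot, LinearMap.comp_apply, LinearEquiv.coe_coe,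
      LinearEquiv.apply_symm_apply]
    rw [numberOp_of_mem hα, numberOp_of_mem ha, map_smul, TensorProduct.tmul_smul,
      ← TensorProduct.smul_tmul', sub_smul, sub_self]

variable [FiniteDimensional ℝ V]

theorem opE'_sum_tmul_ι (vol : (CliffordAlgebra Q)ˣ)
    (hvol : (vol : CliffordAlgebra Q) ∈ clPart Q (Module.finrank ℝ V))
    {κ : Type*} [Fintype κ] (v : κ → V) (d : κ → Module.Dual ℝ T) :
    opE' vol (∑ i, ι Q (v i) ⊗ₜ[ℝ] ExteriorAlgebra.ι ℝ (d i) : Fiber Q T) =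
      ∑ i, TensorProduct.map (clContract Q (v i))
        (LinearMap.mulLeft ℝ (ExteriorAlgebra.ι ℝ (d i))) := by
  refine TensorProduct.ext' fun a α => ?_
  simp only [LinearMap.sum_apply, TensorProduct.map_tmul,
    LinearMap.mulLeft_apply, opE', LinearMap.comp_apply, LinearEquiv.coe_coe]
  rw [opE_sum_tmul_ι]
  simp only [star₁, TensorProduct.congr_tmul, LinearMap.sum_apply, TensorProduct.map_tmul,
    map_sum, TensorProduct.congr_symm_tmul, LinearMap.mulLeft_apply]
  refine Finset.sum_congr rfl fun i _ => ?_
  rw [hodge_symm_clWedge vol hvol]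
  rfl

theorem sharpExt_ι_mul (hQ : (eta Q).Nondegenerate) (e : T ≃ₗ[ℝ] V) (d : Module.Dual ℝ T)
    (α : ExteriorAlgebra ℝ (Module.Dual ℝ T)) :
    sharpExt hQ e (ExteriorAlgebra.ι ℝ d * α) =
      ExteriorAlgebra.ι ℝ (sharp hQ e d) * sharpExt hQ e α := by
  change ExteriorAlgebra.map _ _ = _ * ExteriorAlgebra.map _ α
  rw [map_mul, ExteriorAlgebra.map_apply_ι]
  rfl

/-- Analogue of `hodge_symm_clWedge` on the form side, obtained by transport through `Λ(T*) ≃ Λ(V) ≃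
Cl(V)`. -/
theorem sharpExt_hodgeForms_symm (hQ : (eta Q).Nondegenerate) (vol : (CliffordAlgebra Q)ˣ)
    (hvol : (vol : CliffordAlgebra Q) ∈ clPart Q (Module.finrank ℝ V)) (e : T ≃ₗ[ℝ] V)
    (d : Module.Dual ℝ T) (α : ExteriorAlgebra ℝ (Module.Dual ℝ T)) :
    sharpExt hQ e ((hodgeForms hQ vol e).symm (ExteriorAlgebra.ι ℝ d * hodgeForms hQ vol e α)) =
      contractLeft (Q := (0 : QuadraticForm ℝ V)) (eta Q (sharp hQ e d)) (sharpExt hQ e α) := by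
  have h1 : ∀ β, sharpExt hQ e ((hodgeForms hQ vol e).symm β) = equivExterior Q
      ((hodge vol).symm ((equivExterior Q).symm (sharpExt hQ e β))) := by
    intro β
    simp only [hodgeForms, LinearEquiv.trans_apply, LinearEquiv.trans_symm, LinearEquiv.symm_symm,
      LinearEquiv.apply_symm_apply]
  have h2 : ∀ β, sharpExt hQ e (hodgeForms hQ vol e β) = equivExterior Q
      (hodge vol ((equivExterior Q).symm (sharpExt hQ e β))) := by
    intro β
    simp only [hodgeForms, LinearEquiv.trans_apply, LinearEquiv.trans_symm, LinearEquiv.symm_symm,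
      LinearEquiv.apply_symm_apply]
  rw [h1, sharpExt_ι_mul, h2, equivExterior_symm_ι_mul, LinearEquiv.symm_apply_apply,
    hodge_symm_clWedge vol hvol, equivExterior_clContract, LinearEquiv.apply_symm_apply]

/-- Together with `toTensor_opF'` this shows that, in `Λ(V) ⊗ Λ(V)`, `E'` and `F'` differ by which
factor is contracted and which is multiplied. -/
theorem toTensor_opE' (hQ : (eta Q).Nondegenerate) (vol : (CliffordAlgebra Q)ˣ)
    (hvol : (vol : CliffordAlgebra Q) ∈ clPart Q (Module.finrank ℝ V)) (e : T ≃ₗ[ℝ] V)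
    {κ : Type*} [Fintype κ] (v : κ → V) (d : κ → Module.Dual ℝ T) (x : Fiber Q T) :
    toTensor hQ e (opE' vol (∑ i, ι Q (v i) ⊗ₜ[ℝ] ExteriorAlgebra.ι ℝ (d i)) x) =
      ∑ i, TensorProduct.map (contractLeft (Q := (0 : QuadraticForm ℝ V)) (eta Q (v i)))
        (LinearMap.mulLeft ℝ (ExteriorAlgebra.ι ℝ (sharp hQ e (d i)))) (toTensor hQ e x) := by
  rw [opE'_sum_tmul_ι vol hvol, LinearMap.sum_apply, map_sum]
  refine Finset.sum_congr rfl fun i _ => ?_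
  induction x using TensorProduct.induction_on with
  | zero => simp
  | add x x' hx hx' => simp only [map_add, hx, hx']
  | tmul a α =>
    simp only [toTensor, TensorProduct.map_tmul, TensorProduct.congr_tmul,
      LinearMap.mulLeft_apply]
    rw [equivExterior_clContract, sharpExt_ι_mul]

theorem toTensor_opF' (hQ : (eta Q).Nondegenerate) (vol : (CliffordAlgebra Q)ˣ)
    (hvol : (vol : CliffordAlgebra Q) ∈ clPart Q (Module.finrank ℝ V)) (e : T ≃ₗ[ℝ] V)
    {κ : Type*} [Fintype κ] (v : κ → V) (d : κ → Module.Dual ℝ T) (x : Fiber Q T) :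
    toTensor hQ e (opF' hQ vol e (∑ i, ι Q (v i) ⊗ₜ[ℝ] ExteriorAlgebra.ι ℝ (d i)) x) =
      ∑ i, TensorProduct.map (LinearMap.mulLeft ℝ (ExteriorAlgebra.ι ℝ (v i)))
        (contractLeft (Q := (0 : QuadraticForm ℝ V)) (eta Q (sharp hQ e (d i))))
        (toTensor hQ e x) := by
  rw [opF', LinearMap.comp_apply, LinearMap.comp_apply, opE_sum_tmul_ι, LinearMap.sum_apply,
    map_sum, map_sum]
  refine Finset.sum_congr rfl fun i _ => ?_
  induction x using TensorProduct.induction_on with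
  | zero => simp
  | add x x' hx hx' => simp only [map_add, hx, hx']
  | tmul a α =>
    simp only [toTensor, star₂, LinearEquiv.coe_coe, TensorProduct.congr_tmul,
      TensorProduct.map_tmul, TensorProduct.congr_symm_tmul, LinearMap.mulLeft_apply]
    rw [sharpExt_hodgeForms_symm hQ vol hvol]
    rw [← equivExterior_clWedge]
    rfl

/-- On `Cl^2 ⊗ Λ^2` the operator `-2 E'` is the commutator with the soldering form. -/
theorem neg_two_smul_opE' (vol : (CliffordAlgebra Q)ˣ)
    (hvol : (vol : CliffordAlgebra Q) ∈ clPart Q (Module.finrank ℝ V))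
    {κ : Type*} [Fintype κ] (v : κ → V) (d : κ → Module.Dual ℝ T) {x : Fiber Q T}
    (hx : x ∈ bidegree Q T 2 2) :
    (-2 : ℝ) • opE' vol (∑ i, ι Q (v i) ⊗ₜ[ℝ] ExteriorAlgebra.ι ℝ (d i)) x =
      x * (∑ i, ι Q (v i) ⊗ₜ[ℝ] ExteriorAlgebra.ι ℝ (d i)) -
        (∑ i, ι Q (v i) ⊗ₜ[ℝ] ExteriorAlgebra.ι ℝ (d i)) * x := by
  rw [opE'_sum_tmul_ι vol hvol, LinearMap.sum_apply, Finset.smul_sum, Finset.sum_mul,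
    Finset.mul_sum, ← Finset.sum_sub_distrib]
  refine Finset.sum_congr rfl fun i _ => ?_
  have := map_mem_of_mem_bidegree ⊥ ((-2 : ℝ) • TensorProduct.map (clContract Q (v i))
        (LinearMap.mulLeft ℝ (ExteriorAlgebra.ι ℝ (d i))) -
      (LinearMap.mulRight ℝ (ι Q (v i) ⊗ₜ[ℝ] ExteriorAlgebra.ι ℝ (d i)) -
        LinearMap.mulLeft ℝ (ι Q (v i) ⊗ₜ[ℝ] ExteriorAlgebra.ι ℝ (d i)))) ?_ hx
  · exact sub_eq_zero.1 ((Submodule.mem_bot ℝ).1 this)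
  · intro a ha α hα
    simp only [LinearMap.sub_apply, LinearMap.smul_apply, TensorProduct.map_tmul,
      LinearMap.mulRight_apply, LinearMap.mulLeft_apply, Algebra.TensorProduct.tmul_mul_tmul,
      Submodule.mem_bot, sub_eq_zero]
    have h := involute_mul_ι (d i) α
    -- The degree of `α` is two, so the sign is `+1` and `α` commutes with the one-form.
    rw [involute_mem_exteriorPower hα] at h
    rw [show α * ExteriorAlgebra.ι ℝ (d i) = ExteriorAlgebra.ι ℝ (d i) * α by simpa using h,
      ← TensorProduct.sub_tmul, TensorProduct.smul_tmul', clContract_apply,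
      involute_clPart_two ha]
    congr 1
    rw [smul_smul, show (-2 : ℝ) * (1 / 2) = -1 by norm_num, neg_one_smul, neg_sub]

end Operators
-- The cyclic identity implies pair symmetry.
section Symmetry

open CliffordAlgebra

variable {V : Type*} [AddCommGroup V] [Module ℝ V]

/-- Contraction of the exterior algebra with a covector. -/
noncomputable def extContract (d : Module.Dual ℝ V) :
    ExteriorAlgebra ℝ V →ₗ[ℝ] ExteriorAlgebra ℝ V :=
  contractLeft (Q := (0 : QuadraticForm ℝ V)) d

theorem extContract_ι_mul (d : Module.Dual ℝ V) (v : V) (x : ExteriorAlgebra ℝ V) :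
    extContract d (ExteriorAlgebra.ι ℝ v * x) =
      d v • x - ExteriorAlgebra.ι ℝ v * extContract d x :=
  contractLeft_ι_mul ..

theorem extContract_ι (d : Module.Dual ℝ V) (v : V) :
    extContract d (ExteriorAlgebra.ι ℝ v) = algebraMap ℝ _ (d v) :=
  contractLeft_ι ..

theorem extContract_comm (d d' : Module.Dual ℝ V) (x : ExteriorAlgebra ℝ V) :
    extContract d (extContract d' x) = -extContract d' (extContract d x) :=
  contractLeft_comm ..

theorem extContract_sum_smul {κ : Type*} [Fintype κ] (r : κ → ℝ) (d : κ → Module.Dual ℝ V)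
    (x : ExteriorAlgebra ℝ V) :
    extContract (∑ i, r i • d i) x = ∑ i, r i • extContract (d i) x := by
  simp only [extContract, map_sum, map_smul, LinearMap.sum_apply, LinearMap.smul_apply]

/-- The pairing of an element of the exterior algebra with two covectors. -/
noncomputable def pairing (a b : Module.Dual ℝ V) : ExteriorAlgebra ℝ V →ₗ[ℝ] ℝ :=
  ExteriorAlgebra.algebraMapInv.toLinearMap ∘ₗ extContract a ∘ₗ extContract b

theorem pairing_swap (a b : Module.Dual ℝ V) : pairing b a = -pairing a b := by
  refine LinearMap.ext fun x => ?_
  simp only [pairing, LinearMap.comp_apply, LinearMap.neg_apply, AlgHom.toLinearMap_apply]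
  rw [extContract_comm, map_neg]

theorem pairing_sum_smul {κ : Type*} [Fintype κ] (a : Module.Dual ℝ V) (r : κ → ℝ)
    (d : κ → Module.Dual ℝ V) (x : ExteriorAlgebra ℝ V) :
    ∑ i, r i * pairing a (d i) x = pairing a (∑ i, r i • d i) x := by
  simp only [pairing, LinearMap.comp_apply, extContract_sum_smul, map_sum, map_smul, smul_eq_mul]

/-- The pairing of an element of `Λ(V) ⊗ Λ(V)` with four covectors. -/
noncomputable def pairing₄ (a b c d : Module.Dual ℝ V) :
    ExteriorAlgebra ℝ V ⊗[ℝ] ExteriorAlgebra ℝ V →ₗ[ℝ] ℝ :=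
  LinearMap.mul' ℝ ℝ ∘ₗ TensorProduct.map (pairing a b) (pairing c d)

theorem pairing₄_tmul (a b c d : Module.Dual ℝ V) (x y : ExteriorAlgebra ℝ V) :
    pairing₄ a b c d (x ⊗ₜ y) = pairing a b x * pairing c d y := rfl

theorem pairing₄_swap_left (a b c d : Module.Dual ℝ V)
    (R : ExteriorAlgebra ℝ V ⊗[ℝ] ExteriorAlgebra ℝ V) :
    pairing₄ b a c d R = -pairing₄ a b c d R := by
  rw [pairing₄, pairing_swap, ← neg_one_smul ℝ (pairing a b), TensorProduct.map_smul_left,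
    LinearMap.comp_smul, LinearMap.smul_apply, neg_one_smul]
  rfl

theorem pairing₄_swap_right (a b c d : Module.Dual ℝ V)
    (R : ExteriorAlgebra ℝ V ⊗[ℝ] ExteriorAlgebra ℝ V) :
    pairing₄ a b d c R = -pairing₄ a b c d R := by
  rw [pairing₄, pairing_swap c d, ← neg_one_smul ℝ (pairing c d), TensorProduct.map_smul_right,
    LinearMap.comp_smul, LinearMap.smul_apply, neg_one_smul]
  rfl

/-- The hypothesis `hDu` says that `D` and `u` are dual families. Contracting the second factor `uᵢ
∧ y` with three covectors produces three terms, in each of which one covector is evaluated on `uᵢ`;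
duality then moves that covector to the first factor. -/
theorem pairing₄_bianchi {κ : Type*} [Fintype κ] (D : κ → Module.Dual ℝ V) (u : κ → V)
    (hDu : ∀ d : Module.Dual ℝ V, ∑ i, d (u i) • D i = d)
    {R : ExteriorAlgebra ℝ V ⊗[ℝ] ExteriorAlgebra ℝ V}
    (hR : ∑ i, TensorProduct.map (extContract (D i))
      (LinearMap.mulLeft ℝ (ExteriorAlgebra.ι ℝ (u i))) R = 0) (a b c d : Module.Dual ℝ V) :
    pairing₄ a d b c R - pairing₄ a c b d R + pairing₄ a b c d R = 0 := by
  -- Stated for every tensor, without the hypothesis on `R`, so that induction on tensors applies.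
  have key : ∀ S : ExteriorAlgebra ℝ V ⊗[ℝ] ExteriorAlgebra ℝ V,
      LinearMap.mul' ℝ ℝ (TensorProduct.map
        (ExteriorAlgebra.algebraMapInv.toLinearMap ∘ₗ extContract a)
        (ExteriorAlgebra.algebraMapInv.toLinearMap ∘ₗ extContract b ∘ₗ extContract c ∘ₗ
          extContract d)
        (∑ i, TensorProduct.map (extContract (D i))
          (LinearMap.mulLeft ℝ (ExteriorAlgebra.ι ℝ (u i))) S)) =
      pairing₄ a d b c S - pairing₄ a c b d S + pairing₄ a b c d S := by
    intro S
    induction S using TensorProduct.induction_on with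
    | zero => simp
    | add x y hx hy =>
      simp only [map_add, Finset.sum_add_distrib] at hx hy ⊢
      rw [hx, hy]
      ring
    | tmul x y =>
      simp only [pairing₄_tmul, map_sum, TensorProduct.map_tmul, LinearMap.mul'_apply,
        LinearMap.mulLeft_apply, LinearMap.comp_apply, extContract_ι_mul, map_sub, map_smul,
        AlgHom.toLinearMap_apply, map_mul, smul_eq_mul]
      -- The fourth term, where no covector meets `uᵢ`, still has the factor `uᵢ` and is killed by
      -- projection to degree zero.
      have h0 : ∀ v : V, ExteriorAlgebra.algebraMapInv (ExteriorAlgebra.ι ℝ v) = (0 : ℝ) := by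
        intro v; simp [ExteriorAlgebra.algebraMapInv]
      simp only [h0]
      have h1 : ∀ d' : Module.Dual ℝ V, ∑ i, d' (u i) * pairing a (D i) x = pairing a d' x := by
        intro d'
        rw [pairing_sum_smul, hDu]
      rw [← h1 d, ← h1 c, ← h1 b]
      simp only [Finset.sum_mul, ← Finset.sum_sub_distrib, ← Finset.sum_add_distrib]
      refine Finset.sum_congr rfl fun i _ => ?_
      simp only [pairing, LinearMap.comp_apply, AlgHom.toLinearMap_apply]
      ring
  rw [← key R, hR, map_zero, map_zero]

theorem pairing₄_symm {κ : Type*} [Fintype κ] (D : κ → Module.Dual ℝ V) (u : κ → V)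
    (hDu : ∀ d : Module.Dual ℝ V, ∑ i, d (u i) • D i = d)
    {R : ExteriorAlgebra ℝ V ⊗[ℝ] ExteriorAlgebra ℝ V}
    (hR : ∑ i, TensorProduct.map (extContract (D i))
      (LinearMap.mulLeft ℝ (ExteriorAlgebra.ι ℝ (u i))) R = 0) (a b c d : Module.Dual ℝ V) :
    pairing₄ a b c d R = pairing₄ c d a b R := by
  have B := pairing₄_bianchi D u hDu hR
  have SL := fun a b c d => pairing₄_swap_left (V := V) a b c d R
  have SR := fun a b c d => pairing₄_swap_right (V := V) a b c d R
  -- The classical argument: four cyclic identities, one for each choice of the covector in the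
  -- first slot, combined with the antisymmetries in each pair.
  linarith [B a b c d, B b a c d, B c a b d, B d a b c, SL a b c d, SL a c b d, SL a d b c,
    SL b c a d, SL b d a c, SL c d a b, SR a b c d, SR a c b d, SR a d b c,
    SR b c a d, SR b d a c, SR c d a b, SL a b d c, SL a c d b, SL a d c b,
    SL b c d a, SL b d c a, SL c d b a]

/-- The sum runs over ordered pairs, so each basis bivector is counted twice, whence `1 / 2`. The
covectors appear in reverse order because `pairing` contracts with its second argument before its
first. -/
theorem eq_sum_pairing {κ : Type*} [Fintype κ] (b : Module.Basis κ ℝ V)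
    {x : ExteriorAlgebra ℝ V} (hx : x ∈ ⋀[ℝ]^2 V) :
    x = ∑ p : κ × κ, ((1 / 2 : ℝ) * pairing (b.coord p.2) (b.coord p.1) x) •
      (ExteriorAlgebra.ι ℝ (b p.1) * ExteriorAlgebra.ι ℝ (b p.2)) := by
  rw [exteriorPower_two_eq_span] at hx
  induction hx using Submodule.span_induction with
  | zero => simp
  | add x y _ _ hx hy =>
    simp only [map_add, mul_add, add_smul, Finset.sum_add_distrib, ← hx, ← hy]
  | smul r x _ hx =>
    conv_lhs => rw [hx, Finset.smul_sum]
    refine Finset.sum_congr rfl fun i _ => ?_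
    rw [map_smul, smul_smul, smul_eq_mul]
    congr 1
    ring
  | mem x h =>
    obtain ⟨v, w, rfl⟩ := h
    have hp : ∀ d d' : Module.Dual ℝ V, pairing d' d
        (ExteriorAlgebra.ι ℝ v * ExteriorAlgebra.ι ℝ w) = d v * d' w - d w * d' v := by
      intro d d'
      simp only [pairing, LinearMap.comp_apply, extContract_ι_mul, extContract_ι, map_sub,
        map_smul, AlgHom.toLinearMap_apply, ← Algebra.commutes (R := ℝ), ← Algebra.smul_def]
      simp [ExteriorAlgebra.algebraMapInv]
    have hs : ∀ v w : V, ∑ p : κ × κ, (b.coord p.1 v * b.coord p.2 w) •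
        (ExteriorAlgebra.ι ℝ (b p.1) * ExteriorAlgebra.ι ℝ (b p.2)) =
        ExteriorAlgebra.ι ℝ v * ExteriorAlgebra.ι ℝ w := by
      intro v w
      conv_rhs => rw [← b.sum_repr v, ← b.sum_repr w]
      rw [map_sum, map_sum, Finset.sum_mul_sum, Fintype.sum_prod_type]
      refine Finset.sum_congr rfl fun i _ => Finset.sum_congr rfl fun j _ => ?_
      rw [map_smul, map_smul, smul_mul_smul_comm]
      rfl
    simp only [hp]
    have : ∀ p : κ × κ, ((1 / 2 : ℝ) * (b.coord p.1 v * b.coord p.2 w -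
        b.coord p.1 w * b.coord p.2 v)) •
        (ExteriorAlgebra.ι ℝ (b p.1) * ExteriorAlgebra.ι ℝ (b p.2)) =
        (1 / 2 : ℝ) • ((b.coord p.1 v * b.coord p.2 w) •
        (ExteriorAlgebra.ι ℝ (b p.1) * ExteriorAlgebra.ι ℝ (b p.2)) -
        (b.coord p.1 w * b.coord p.2 v) •
        (ExteriorAlgebra.ι ℝ (b p.1) * ExteriorAlgebra.ι ℝ (b p.2))) := by
      intro p
      module
    simp only [this]
    rw [← Finset.smul_sum, Finset.sum_sub_distrib, hs, hs, ι_mul_ι_anticomm v w]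
    module

theorem eq_sum_pairing₄ {κ : Type*} [Fintype κ] (b : Module.Basis κ ℝ V)
    {R : ExteriorAlgebra ℝ V ⊗[ℝ] ExteriorAlgebra ℝ V}
    (hR : R ∈ LinearMap.range (TensorProduct.map (⋀[ℝ]^2 V).subtype (⋀[ℝ]^2 V).subtype)) :
    R = ∑ p : κ × κ, ∑ q : κ × κ, ((1 / 4 : ℝ) *
      pairing₄ (b.coord p.2) (b.coord p.1) (b.coord q.2) (b.coord q.1) R) •
      ((ExteriorAlgebra.ι ℝ (b p.1) * ExteriorAlgebra.ι ℝ (b p.2)) ⊗ₜ[ℝ]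
        (ExteriorAlgebra.ι ℝ (b q.1) * ExteriorAlgebra.ι ℝ (b q.2))) := by
  rw [TensorProduct.range_map_eq_span_tmul] at hR
  induction hR using Submodule.span_induction with
  | zero => simp
  | add x y _ _ hx hy =>
    simp only [map_add, mul_add, add_smul, Finset.sum_add_distrib, ← hx, ← hy]
  | smul r x _ hx =>
    conv_lhs => rw [hx, Finset.smul_sum]
    refine Finset.sum_congr rfl fun i _ => ?_
    rw [Finset.smul_sum]
    refine Finset.sum_congr rfl fun j _ => ?_
    rw [map_smul, smul_smul, smul_eq_mul]
    congr 1
    ring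
  | mem x h =>
    obtain ⟨⟨x, hx⟩, ⟨y, hy⟩, rfl⟩ := h
    simp only [Submodule.subtype_apply, pairing₄_tmul]
    conv_lhs => rw [eq_sum_pairing b hx, eq_sum_pairing b hy, TensorProduct.sum_tmul]
    refine Finset.sum_congr rfl fun i _ => ?_
    rw [TensorProduct.tmul_sum]
    refine Finset.sum_congr rfl fun j _ => ?_
    rw [TensorProduct.smul_tmul_smul]
    congr 1
    ring

/-- The first Bianchi identity implies the pair symmetry of the curvature. -/
theorem comm_eq_self_of_bianchi {κ κ' : Type*} [Fintype κ] [Fintype κ'] (b : Module.Basis κ' ℝ V)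
    (D : κ → Module.Dual ℝ V) (u : κ → V)
    (hDu : ∀ d : Module.Dual ℝ V, ∑ i, d (u i) • D i = d)
    {R : ExteriorAlgebra ℝ V ⊗[ℝ] ExteriorAlgebra ℝ V}
    (hmem : R ∈ LinearMap.range (TensorProduct.map (⋀[ℝ]^2 V).subtype (⋀[ℝ]^2 V).subtype))
    (hR : ∑ i, TensorProduct.map (extContract (D i))
      (LinearMap.mulLeft ℝ (ExteriorAlgebra.ι ℝ (u i))) R = 0) :
    TensorProduct.comm ℝ _ _ R = R := by
  conv_lhs => rw [eq_sum_pairing₄ b hmem]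
  conv_rhs => rw [eq_sum_pairing₄ b hmem, Finset.sum_comm]
  simp only [map_sum, map_smul, TensorProduct.comm_tmul]
  refine Finset.sum_congr rfl fun i _ => Finset.sum_congr rfl fun j _ => ?_
  rw [pairing₄_symm D u hDu hR]

end Symmetry

/-! ### From `E'R = 0` to the symmetry of `R` and `F'R = 0`. -/

section Curvature

variable {V : Type*} [AddCommGroup V] [Module ℝ V] [FiniteDimensional ℝ V] {Q : QuadraticForm ℝ V}
  {T : Type*} [AddCommGroup T] [Module ℝ T]

/-- An orthogonal basis together with the scaling that gives the dual basis. -/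
theorem exists_basis_coord_eq (hQ : (eta Q).Nondegenerate) :
    ∃ (b : Module.Basis (Fin (Module.finrank ℝ V)) ℝ V) (c : Fin (Module.finrank ℝ V) → ℝ),
      ∀ i, eta Q (c i • b i) = b.coord i := by
  obtain ⟨b, hb⟩ := LinearMap.BilinForm.exists_orthogonal_basis
    (QuadraticForm.associated_isSymm ℝ Q)
  -- Nondegeneracy makes each diagonal value of `η` in an orthogonal basis nonzero; its inverse
  -- normalises `bᵢ` to the vector dual to itself.
  refine ⟨b, fun i => (eta Q (b i) (b i))⁻¹, fun i => b.ext fun j => ?_⟩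
  rw [map_smul, LinearMap.smul_apply, smul_eq_mul, Module.Basis.coord_apply,
    Module.Basis.repr_self, Finsupp.single_apply]
  split_ifs with h
  · subst h
    exact inv_mul_cancel₀ (LinearMap.IsOrthoᵢ.not_isOrtho_basis_self_of_separatingLeft hb hQ.1 j)
  · have : eta Q (b i) (b j) = 0 := hb (Ne.symm h)
    rw [this, mul_zero]

theorem sharp_dualMap_coord (hQ : (eta Q).Nondegenerate) (e : T ≃ₗ[ℝ] V)
    {d : Module.Dual ℝ V} {u : V} (h : eta Q u = d) : sharp hQ e (e.dualMap d) = u := by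
  rw [sharp, LinearEquiv.trans_apply, LinearEquiv.symm_apply_eq]
  refine LinearMap.ext fun w => ?_
  rw [LinearMap.BilinForm.toDual_def, h]
  simp

theorem sharpExt_mem_exteriorPower (hQ : (eta Q).Nondegenerate) (e : T ≃ₗ[ℝ] V) {q : ℕ}
    {α : ExteriorAlgebra ℝ (Module.Dual ℝ T)} (hα : α ∈ ⋀[ℝ]^q (Module.Dual ℝ T)) :
    sharpExt hQ e α ∈ ⋀[ℝ]^q V := by
  have := Submodule.mem_map_of_mem
    (f := (ExteriorAlgebra.map (sharp hQ e).toLinearMap).toLinearMap) hα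
  rw [ExteriorAlgebra.exteriorPower, Submodule.map_pow] at this
  refine (pow_le_pow_left' (?_ : Submodule.map _ _ ≤ _) q) this
  rintro _ ⟨_, ⟨d, rfl⟩, rfl⟩
  exact ⟨_, (ExteriorAlgebra.map_apply_ι _ _).symm⟩

theorem toTensor_mem_range (hQ : (eta Q).Nondegenerate) (e : T ≃ₗ[ℝ] V) {p q : ℕ}
    {x : Fiber Q T} (hx : x ∈ bidegree Q T p q) :
    toTensor hQ e x ∈
      LinearMap.range (TensorProduct.map (⋀[ℝ]^p V).subtype (⋀[ℝ]^q V).subtype) := by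
  refine map_mem_of_mem_bidegree _ (toTensor hQ e).toLinearMap ?_ hx
  rintro _ ⟨a, ha, rfl⟩ α hα
  refine ⟨(⟨a, ha⟩ : ⋀[ℝ]^p V) ⊗ₜ ⟨_, sharpExt_mem_exteriorPower hQ e hα⟩, ?_⟩
  rw [TensorProduct.map_tmul]
  simp only [toTensor, LinearEquiv.coe_coe, TensorProduct.congr_tmul,
    LinearEquiv.apply_symm_apply, Submodule.subtype_apply]

variable (hQ : (eta Q).Nondegenerate) (vol : (CliffordAlgebra Q)ˣ)
    (hvol : (vol : CliffordAlgebra Q) ∈ clPart Q (Module.finrank ℝ V)) (e : T ≃ₗ[ℝ] V)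
    {θ : Fiber Q T} (hθ : θ ∈ bidegree Q T 1 1)
    (he : ∀ X : T, interior X θ = CliffordAlgebra.ι Q (e X) ⊗ₜ[ℝ] 1)
    {R : Fiber Q T} (hR : R ∈ bidegree Q T 2 2)

include hvol hθ he hR in
theorem commutator_soldering_eq_opE' : R * θ - θ * R = (-2 : ℝ) • opE' vol θ R := by
  rw [eq_sum_frame (Module.finBasis ℝ V) hθ e he, neg_two_smul_opE' vol hvol _ _ hR]

include hvol hθ he hR in
theorem comm_toTensor_of_opE'_eq_zero (h : opE' vol θ R = 0) :
    TensorProduct.comm ℝ _ _ (toTensor hQ e R) = toTensor hQ e R := by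
  obtain ⟨b, c, hbc⟩ := exists_basis_coord_eq hQ
  have h' := congrArg (toTensor hQ e) h
  rw [eq_sum_frame b hθ e he, toTensor_opE' hQ vol hvol, map_zero] at h'
  simp only [sharp_dualMap_coord hQ e (hbc _)] at h'
  -- The dual families are `η(bᵢ, ·)` and `cᵢ bᵢ`; the latter is the vector that `η` matches with
  -- the coordinate covector of `bᵢ`.
  refine comm_eq_self_of_bianchi b (fun i => eta Q (b i)) (fun i => c i • b i) ?_
    (toTensor_mem_range hQ e hR) h'
  intro d
  refine b.ext fun j => ?_
  have h1 : ∀ i, d (c i • b i) • eta Q (b i) = d (b i) • b.coord i := by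
    intro i
    rw [← hbc, map_smul, map_smul, smul_eq_mul, mul_comm, mul_smul]
  simp only [h1]
  simp

include hvol hθ he hR in
theorem opF'_eq_zero_of_opE'_eq_zero (h : opE' vol θ R = 0) : opF' hQ vol e θ R = 0 := by
  have hs := comm_toTensor_of_opE'_eq_zero hQ vol hvol e hθ he hR h
  obtain ⟨b, c, hbc⟩ := exists_basis_coord_eq hQ
  apply (toTensor hQ e).injective
  have h' := congrArg (toTensor hQ e) h
  rw [eq_sum_frame b hθ e he] at h' ⊢
  rw [toTensor_opE' hQ vol hvol, map_zero] at h'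
  rw [toTensor_opF' hQ vol hvol, map_zero]
  simp only [sharp_dualMap_coord hQ e (hbc _)] at h' ⊢
  -- Exchanging the factors in the equation `E'R = 0` gives a sum that matches `F'R` term by term,
  -- since `R` itself is unchanged.
  have h'' := congrArg (TensorProduct.comm ℝ _ _) h'
  rw [map_sum, map_zero] at h''
  rw [← h'']
  refine Finset.sum_congr rfl fun i _ => ?_
  -- The normalising scalar `cᵢ` passes from the contraction to the wedge across the tensor product.
  have hc : TensorProduct.map
      (LinearMap.mulLeft ℝ (ExteriorAlgebra.ι ℝ (b i)))
        (CliffordAlgebra.contractLeft (Q := (0 : QuadraticForm ℝ V)) (eta Q (c i • b i))) =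
      TensorProduct.map (LinearMap.mulLeft ℝ (ExteriorAlgebra.ι ℝ (c i • b i)))
        (CliffordAlgebra.contractLeft (Q := (0 : QuadraticForm ℝ V)) (eta Q (b i))) := by
    refine TensorProduct.ext' fun x y => ?_
    simp only [TensorProduct.map_tmul, LinearMap.mulLeft_apply, map_smul, LinearMap.smul_apply,
      smul_mul_assoc, TensorProduct.tmul_smul, TensorProduct.smul_tmul']
  rw [hc, ← TensorProduct.map_comm, hs]

end Curvature
-- Differential calculus for functions with values in a space without a chosen norm.
section Calculus

open Filter Topology

variable {n : ℕ} {W W' W'' : Type*} [AddCommGroup W] [Module ℝ W]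
  [AddCommGroup W'] [Module ℝ W'] [AddCommGroup W''] [Module ℝ W'']

/-- Smoothness of a function with values in a real vector space, tested by linear functionals. -/
def SmoothOn (f : EuclideanSpace ℝ (Fin n) → W) (U : Set (EuclideanSpace ℝ (Fin n))) : Prop :=
  ∀ φ : Module.Dual ℝ W, ContDiffOn ℝ ((⊤ : ℕ∞) : WithTop ℕ∞) (fun y => φ (f y)) U

variable {f g : EuclideanSpace ℝ (Fin n) → W} {U : Set (EuclideanSpace ℝ (Fin n))}
  {v w y : EuclideanSpace ℝ (Fin n)}

theorem SmoothOn.congr (hf : SmoothOn f U) (h : ∀ z ∈ U, g z = f z) : SmoothOn g U :=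
  fun φ => (hf φ).congr fun z hz => by rw [h z hz]

theorem SmoothOn.const (c : W) : SmoothOn (fun _ => c) U := fun _ => contDiffOn_const

theorem SmoothOn.add (hf : SmoothOn f U) (hg : SmoothOn g U) : SmoothOn (fun z => f z + g z) U :=
  fun φ => by simpa only [map_add] using (hf φ).add (hg φ)

theorem SmoothOn.sum {κ : Type*} [Fintype κ] {F : κ → EuclideanSpace ℝ (Fin n) → W}
    (hF : ∀ i, SmoothOn (F i) U) : SmoothOn (fun z => ∑ i, F i z) U :=
  fun φ => by
    simp only [map_sum]
    exact ContDiffOn.sum fun i _ => hF i φ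

theorem SmoothOn.linear (hf : SmoothOn f U) (L : W →ₗ[ℝ] W') : SmoothOn (fun z => L (f z)) U :=
  fun φ => hf (φ ∘ₗ L)

theorem SmoothOn.smul {r : EuclideanSpace ℝ (Fin n) → ℝ}
    (hr : ContDiffOn ℝ ((⊤ : ℕ∞) : WithTop ℕ∞) r U) (hf : SmoothOn f U) :
    SmoothOn (fun z => r z • f z) U :=
  fun φ => by simpa only [map_smul, smul_eq_mul] using hr.mul (hf φ)

/-- Expanding only the left argument writes a bilinear map as a sum of scalars times linear maps, so
smoothness and the Leibniz rule for products reduce to scalar multiplication. -/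
theorem bilin_eq_sum [FiniteDimensional ℝ W] (B : W →ₗ[ℝ] W' →ₗ[ℝ] W'') (x : W) (x' : W') :
    B x x' = ∑ i, (Module.finBasis ℝ W).coord i x • B (Module.finBasis ℝ W i) x' := by
  conv_lhs => rw [← (Module.finBasis ℝ W).sum_repr x]
  simp only [map_sum, map_smul, LinearMap.sum_apply, LinearMap.smul_apply,
    Module.Basis.coord_apply]

theorem SmoothOn.bilin [FiniteDimensional ℝ W] (hf : SmoothOn f U)
    {g : EuclideanSpace ℝ (Fin n) → W'} (hg : SmoothOn g U) (B : W →ₗ[ℝ] W' →ₗ[ℝ] W'') :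
    SmoothOn (fun z => B (f z) (g z)) U := by
  refine SmoothOn.congr ?_ fun z _ => bilin_eq_sum B (f z) (g z)
  exact SmoothOn.sum fun i => SmoothOn.smul (hf _) (hg.linear _)

theorem SmoothOn.differentiableAt (hf : SmoothOn f U) (hU : IsOpen U) (hy : y ∈ U)
    (φ : Module.Dual ℝ W) : DifferentiableAt ℝ (fun z => φ (f z)) y :=
  ((hf φ).contDiffAt (hU.mem_nhds hy)).differentiableAt (by simp)

theorem eq_of_forall_dual {x x' : W} (h : ∀ φ : Module.Dual ℝ W, φ x = φ x') : x = x' := by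
  rw [← sub_eq_zero, ← Module.forall_dual_apply_eq_zero_iff ℝ]
  intro φ
  rw [map_sub, h, sub_self]

variable [FiniteDimensional ℝ W] [FiniteDimensional ℝ W'] [FiniteDimensional ℝ W'']

/-- Basis-free description of `dirDeriv`. Since functionals separate points, the rules below reduce
to facts about `fderiv` of real functions. -/
theorem dual_dirDeriv (hf : SmoothOn f U) (hU : IsOpen U) (hy : y ∈ U) (φ : Module.Dual ℝ W) :
    φ (dirDeriv f v y) = fderiv ℝ (fun z => φ (f z)) y v := by
  have h : (fun z => φ (f z)) = fun z => ∑ j, φ (Module.finBasis ℝ W j) *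
      (Module.finBasis ℝ W).coord j (f z) := by
    funext z
    conv_lhs => rw [← (Module.finBasis ℝ W).sum_repr (f z)]
    simp only [map_sum, map_smul, Module.Basis.coord_apply, smul_eq_mul, mul_comm]
  rw [h, fderiv_fun_sum fun j _ => (hf.differentiableAt hU hy _).const_mul _,
    sum_apply, dirDeriv, map_sum]
  refine Finset.sum_congr rfl fun j _ => ?_
  rw [fderiv_const_mul (hf.differentiableAt hU hy _), map_smul, smul_eq_mul, mul_comm]
  rfl

theorem dirDeriv_congr (h : f =ᶠ[𝓝 y] g) : dirDeriv f v y = dirDeriv g v y := by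
  rw [dirDeriv, dirDeriv]
  refine Finset.sum_congr rfl fun j _ => ?_
  have : (fun z => (Module.finBasis ℝ W).coord j (f z)) =ᶠ[𝓝 y]
      fun z => (Module.finBasis ℝ W).coord j (g z) := h.fun_comp _
  rw [this.fderiv_eq]

theorem dirDeriv_const (c : W) : dirDeriv (fun _ => c) v y = 0 := by
  simp [dirDeriv]

theorem dirDeriv_add (hf : SmoothOn f U) (hg : SmoothOn g U) (hU : IsOpen U) (hy : y ∈ U) :
    dirDeriv (fun z => f z + g z) v y = dirDeriv f v y + dirDeriv g v y := by
  refine eq_of_forall_dual fun φ => ?_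
  rw [dual_dirDeriv (hf.add hg) hU hy, map_add, dual_dirDeriv hf hU hy, dual_dirDeriv hg hU hy]
  simp only [map_add]
  rw [fderiv_fun_add (hf.differentiableAt hU hy _) (hg.differentiableAt hU hy _)]
  rfl

theorem dirDeriv_sum {κ : Type*} [Fintype κ] {F : κ → EuclideanSpace ℝ (Fin n) → W}
    (hF : ∀ i, SmoothOn (F i) U) (hU : IsOpen U) (hy : y ∈ U) :
    dirDeriv (fun z => ∑ i, F i z) v y = ∑ i, dirDeriv (F i) v y := by
  refine eq_of_forall_dual fun φ => ?_
  rw [dual_dirDeriv (SmoothOn.sum hF) hU hy, map_sum]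
  simp only [map_sum]
  rw [fderiv_fun_sum fun i _ => (hF i).differentiableAt hU hy _, sum_apply]
  exact Finset.sum_congr rfl fun i _ => (dual_dirDeriv (hF i) hU hy φ).symm

theorem dirDeriv_linear (hf : SmoothOn f U) (hU : IsOpen U) (hy : y ∈ U) (L : W →ₗ[ℝ] W') :
    dirDeriv (fun z => L (f z)) v y = L (dirDeriv f v y) := by
  refine eq_of_forall_dual fun φ => ?_
  rw [dual_dirDeriv (hf.linear L) hU hy]
  exact (dual_dirDeriv hf hU hy (φ ∘ₗ L)).symm

theorem dirDeriv_smul {r : EuclideanSpace ℝ (Fin n) → ℝ}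
    (hr : ContDiffOn ℝ ((⊤ : ℕ∞) : WithTop ℕ∞) r U) (hf : SmoothOn f U)
    (hU : IsOpen U) (hy : y ∈ U) :
    dirDeriv (fun z => r z • f z) v y = fderiv ℝ r y v • f y + r y • dirDeriv f v y := by
  refine eq_of_forall_dual fun φ => ?_
  rw [dual_dirDeriv (SmoothOn.smul hr hf) hU hy, map_add, map_smul, map_smul,
    dual_dirDeriv hf hU hy]
  simp only [map_smul, smul_eq_mul]
  rw [fderiv_fun_mul ((hr.contDiffAt (hU.mem_nhds hy)).differentiableAt (by simp))
    (hf.differentiableAt hU hy _)]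
  simp only [add_apply, smul_apply, smul_eq_mul]
  ring

theorem dirDeriv_bilin (hf : SmoothOn f U) {g : EuclideanSpace ℝ (Fin n) → W'}
    (hg : SmoothOn g U) (hU : IsOpen U) (hy : y ∈ U) (B : W →ₗ[ℝ] W' →ₗ[ℝ] W'') :
    dirDeriv (fun z => B (f z) (g z)) v y = B (dirDeriv f v y) (g y) + B (f y) (dirDeriv g v y) := by
  rw [show (fun z => B (f z) (g z)) = _ from funext fun z => bilin_eq_sum B (f z) (g z),
    bilin_eq_sum B (dirDeriv f v y), bilin_eq_sum B (f y),
    dirDeriv_sum (fun i => SmoothOn.smul (hf _) (hg.linear _)) hU hy,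
    ← Finset.sum_add_distrib]
  refine Finset.sum_congr rfl fun i _ => ?_
  rw [dirDeriv_smul (hf _) (hg.linear _) hU hy, dirDeriv_linear hg hU hy, dual_dirDeriv hf hU hy]

theorem SmoothOn.dirDeriv (hf : SmoothOn f U) (hU : IsOpen U) (v : EuclideanSpace ℝ (Fin n)) :
    SmoothOn (dirDeriv f v) U := by
  intro φ
  refine ContDiffOn.congr (f := fun z => fderiv ℝ (fun z => φ (f z)) z v) ?_
    fun z hz => dual_dirDeriv hf hU hz φ
  exact ((hf φ).fderiv_of_isOpen hU (by simp)).clm_apply contDiffOn_const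

theorem dirDeriv_comm (hf : SmoothOn f U) (hU : IsOpen U) (hy : y ∈ U) :
    dirDeriv (dirDeriv f v) w y = dirDeriv (dirDeriv f w) v y := by
  refine eq_of_forall_dual fun φ => ?_
  have h : ∀ v w, φ (dirDeriv (dirDeriv f v) w y) =
      fderiv ℝ (fderiv ℝ (fun z => φ (f z))) y w v := by
    intro v w
    rw [dual_dirDeriv (hf.dirDeriv hU v) hU hy]
    have : (fun z => φ (dirDeriv f v z)) =ᶠ[𝓝 y] fun z => fderiv ℝ (fun z => φ (f z)) z v :=
      eventually_of_mem (hU.mem_nhds hy) fun z hz => dual_dirDeriv hf hU hz φ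
    have hd : DifferentiableAt ℝ (fderiv ℝ (fun z => φ (f z))) y :=
      (((hf φ).fderiv_of_isOpen (m := 1) hU (by norm_cast)).contDiffAt
        (hU.mem_nhds hy)).differentiableAt (by simp)
    rw [this.fderiv_eq, fderiv_clm_apply hd (differentiableAt_const v)]
    simp
  rw [h, h]
  exact (((hf φ).contDiffAt (hU.mem_nhds hy)).isSymmSndFDerivAt
    (by simpa using WithTop.coe_le_coe.2 (le_top : (2 : ℕ∞) ≤ ⊤))).eq _ _

/-- A subspace is the common kernel of its annihilator, and a functional vanishing along `f` near
`y` has zero derivative. This keeps the bidegree fixed under differentiation. -/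
theorem dirDeriv_mem (hf : SmoothOn f U) (hU : IsOpen U) (hy : y ∈ U) (S : Submodule ℝ W)
    (h : ∀ z ∈ U, f z ∈ S) : dirDeriv f v y ∈ S := by
  rw [← Subspace.forall_mem_dualAnnihilator_apply_eq_zero_iff]
  intro φ hφ
  rw [dual_dirDeriv hf hU hy]
  have : (fun z => φ (f z)) =ᶠ[𝓝 y] fun _ => 0 :=
    eventually_of_mem (hU.mem_nhds hy) fun z hz =>
      (Submodule.mem_dualAnnihilator φ).1 hφ _ (h z hz)
  rw [this.fderiv_eq]
  simp

end Calculus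

/-! ### Differentials of scalar functions as Clifford forms. -/

section Differential

variable {n : ℕ} {V : Type*} [AddCommGroup V] [Module ℝ V] {Q : QuadraticForm ℝ V}

theorem dx_mul (i : Fin n) (x : Fiber Q (EuclideanSpace ℝ (Fin n))) :
    dx Q i * x = formSign x * dx Q i :=
  one_tmul_ι_mul _ _

/-- The differential of a function, as a Clifford form. -/
noncomputable def scalarD (Q : QuadraticForm ℝ V) (r : EuclideanSpace ℝ (Fin n) → ℝ)
    (y : EuclideanSpace ℝ (Fin n)) : Fiber Q (EuclideanSpace ℝ (Fin n)) :=
  1 ⊗ₜ[ℝ] ExteriorAlgebra.ι ℝ (fderiv ℝ r y).toLinearMap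

theorem scalarD_eq_sum (r : EuclideanSpace ℝ (Fin n) → ℝ) (y : EuclideanSpace ℝ (Fin n)) :
    scalarD Q r y = ∑ i, fderiv ℝ r y (EuclideanSpace.single i 1) • dx Q i := by
  have h : (fderiv ℝ r y).toLinearMap = ∑ i, fderiv ℝ r y (EuclideanSpace.single i 1) •
      (EuclideanSpace.basisFun (Fin n) ℝ).toBasis.coord i := by
    refine (EuclideanSpace.basisFun (Fin n) ℝ).toBasis.ext fun j => ?_
    simp
  rw [scalarD, h, map_sum, TensorProduct.tmul_sum]
  simp only [map_smul, TensorProduct.tmul_smul]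
  rfl

theorem pullback_scalarD {y : EuclideanSpace ℝ (Fin n)}
    {ψ : EuclideanSpace ℝ (Fin n) → EuclideanSpace ℝ (Fin n)}
    {r : EuclideanSpace ℝ (Fin n) → ℝ} (hr : DifferentiableAt ℝ r (ψ y))
    (hψ : DifferentiableAt ℝ ψ y) :
    pullback Q (fderiv ℝ ψ y).toLinearMap (scalarD Q r (ψ y)) =
      scalarD Q (fun z => r (ψ z)) y := by
  rw [scalarD, pullback_tmul, ExteriorAlgebra.map_apply_ι, scalarD]
  have : fderiv ℝ (fun z => r (ψ z)) y = (fderiv ℝ r (ψ y)).comp (fderiv ℝ ψ y) :=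
    fderiv_comp y hr hψ
  rw [this]
  rfl

end Differential

/-! ### The exterior derivative in Euclidean space: Leibniz, `d² = 0`, naturality. -/

section ExteriorDerivative

open Filter Topology

variable {n : ℕ} {V : Type*} [AddCommGroup V] [Module ℝ V] [FiniteDimensional ℝ V]
  {Q : QuadraticForm ℝ V}
  {f g : EuclideanSpace ℝ (Fin n) → Fiber Q (EuclideanSpace ℝ (Fin n))}
  {U : Set (EuclideanSpace ℝ (Fin n))} {y : EuclideanSpace ℝ (Fin n)}

theorem SmoothOn.mul (hf : SmoothOn f U) (hg : SmoothOn g U) : SmoothOn (fun z => f z * g z) U :=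
  hf.bilin hg (LinearMap.mul ℝ _)

theorem SmoothOn.dEuclidean (hf : SmoothOn f U) (hU : IsOpen U) : SmoothOn (dEuclidean f) U :=
  SmoothOn.sum fun i => (hf.dirDeriv hU (EuclideanSpace.single i 1)).linear
    (LinearMap.mulLeft ℝ (dx Q i))

theorem dEuclidean_congr (h : f =ᶠ[𝓝 y] g) : dEuclidean f y = dEuclidean g y := by
  simp only [dEuclidean, dirDeriv_congr h]

theorem dEuclidean_const (c : Fiber Q (EuclideanSpace ℝ (Fin n))) :
    dEuclidean (fun _ => c) y = 0 := by
  simp [dEuclidean, dirDeriv_const]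

theorem dEuclidean_add (hf : SmoothOn f U) (hg : SmoothOn g U) (hU : IsOpen U) (hy : y ∈ U) :
    dEuclidean (fun z => f z + g z) y = dEuclidean f y + dEuclidean g y := by
  simp only [dEuclidean, dirDeriv_add hf hg hU hy, mul_add, Finset.sum_add_distrib]

theorem dEuclidean_sum {κ : Type*} [Fintype κ]
    {F : κ → EuclideanSpace ℝ (Fin n) → Fiber Q (EuclideanSpace ℝ (Fin n))}
    (hF : ∀ i, SmoothOn (F i) U) (hU : IsOpen U) (hy : y ∈ U) :
    dEuclidean (fun z => ∑ i, F i z) y = ∑ i, dEuclidean (F i) y := by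
  simp only [dEuclidean, dirDeriv_sum hF hU hy, Finset.mul_sum]
  exact Finset.sum_comm

theorem dEuclidean_mul (hf : SmoothOn f U) (hg : SmoothOn g U) (hU : IsOpen U) (hy : y ∈ U) :
    dEuclidean (fun z => f z * g z) y =
      dEuclidean f y * g y + formSign (f y) * dEuclidean g y := by
  simp only [dEuclidean]
  rw [Finset.sum_mul, Finset.mul_sum, ← Finset.sum_add_distrib]
  refine Finset.sum_congr rfl fun i _ => ?_
  have := dirDeriv_bilin (v := EuclideanSpace.single i 1) hf hg hU hy (LinearMap.mul ℝ _)
  simp only [LinearMap.mul_apply'] at this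
  rw [this, mul_add, ← mul_assoc, ← mul_assoc, ← mul_assoc, dx_mul i (f y)]

theorem dEuclidean_dEuclidean (hf : SmoothOn f U) (hU : IsOpen U) (hy : y ∈ U) :
    dEuclidean (dEuclidean f) y = 0 := by
  have h : ∀ i, dirDeriv (dEuclidean f) (EuclideanSpace.single i 1) y =
      ∑ j, dx Q j * dirDeriv (dirDeriv f (EuclideanSpace.single j 1))
        (EuclideanSpace.single i 1) y := by
    intro i
    have := dirDeriv_sum (v := EuclideanSpace.single i 1)
      (fun j => (hf.dirDeriv hU (EuclideanSpace.single j 1)).linear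
        (LinearMap.mulLeft ℝ (dx Q j))) hU hy
    refine this.trans (Finset.sum_congr rfl fun j _ => ?_)
    rw [dirDeriv_linear (hf.dirDeriv hU _) hU hy]
    rfl
  have hanti : ∀ i j : Fin n, dx Q i * dx Q j = -(dx Q j * dx Q i) := by
    intro i j
    rw [dx, dx, Algebra.TensorProduct.tmul_mul_tmul, Algebra.TensorProduct.tmul_mul_tmul,
      ι_mul_ι_anticomm, TensorProduct.tmul_neg]
  -- Second derivatives are symmetric and the `dxⁱ` anticommute, so interchanging the two indices
  -- shows that the double sum equals its own negative.
  have hS : dEuclidean (dEuclidean f) y = -dEuclidean (dEuclidean f) y := by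
    conv_lhs => rw [dEuclidean]
    conv_rhs => rw [dEuclidean]
    simp only [h, Finset.mul_sum]
    conv_rhs => rw [Finset.sum_comm]
    simp only [← Finset.sum_neg_distrib]
    refine Finset.sum_congr rfl fun i _ => Finset.sum_congr rfl fun j _ => ?_
    rw [← mul_assoc, ← mul_assoc, hanti i j, neg_mul, dirDeriv_comm hf hU hy]
  have h2 : (2 : ℝ) • dEuclidean (dEuclidean f) y = 0 := by
    rw [two_smul]
    nth_rewrite 1 [hS]
    exact neg_add_cancel _
  exact (smul_eq_zero.1 h2).resolve_left two_ne_zero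

theorem dEuclidean_mem_bidegree (hf : SmoothOn f U) (hU : IsOpen U) (hy : y ∈ U) {p q : ℕ}
    (h : ∀ z ∈ U, f z ∈ bidegree Q (EuclideanSpace ℝ (Fin n)) p q) :
    dEuclidean f y ∈ bidegree Q (EuclideanSpace ℝ (Fin n)) p (q + 1) :=
  Submodule.sum_mem _ fun _ _ => one_tmul_ι_mul_mem_bidegree _ (dirDeriv_mem hf hU hy _ h)

theorem dEuclidean_smul {r : EuclideanSpace ℝ (Fin n) → ℝ}
    (hr : ContDiffOn ℝ ((⊤ : ℕ∞) : WithTop ℕ∞) r U) (hf : SmoothOn f U)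
    (hU : IsOpen U) (hy : y ∈ U) :
    dEuclidean (fun z => r z • f z) y = scalarD Q r y * f y + r y • dEuclidean f y := by
  rw [scalarD_eq_sum, Finset.sum_mul]
  simp only [dEuclidean]
  rw [Finset.smul_sum, ← Finset.sum_add_distrib]
  refine Finset.sum_congr rfl fun i _ => ?_
  rw [dirDeriv_smul hr hf hU hy, mul_add, mul_smul_comm, mul_smul_comm, smul_mul_assoc]

variable {U' : Set (EuclideanSpace ℝ (Fin n))}
  {ψ : EuclideanSpace ℝ (Fin n) → EuclideanSpace ℝ (Fin n)}

/-- The pullback of a constant form is smooth and closed. -/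
theorem pullback_const_closed (hU : IsOpen U) (hψ : ContDiffOn ℝ ((⊤ : ℕ∞) : WithTop ℕ∞) ψ U)
    (c : Fiber Q (EuclideanSpace ℝ (Fin n))) :
    SmoothOn (fun z => pullback Q (fderiv ℝ ψ z).toLinearMap c) U ∧
      ∀ y ∈ U, dEuclidean (fun z => pullback Q (fderiv ℝ ψ z).toLinearMap c) y = 0 := by
  -- The property passes to products and sums, so it is enough to check the generators `a ⊗ 1` and
  -- `1 ⊗ d`.
  have hmul : ∀ c c' : Fiber Q (EuclideanSpace ℝ (Fin n)),
      (SmoothOn (fun z => pullback Q (fderiv ℝ ψ z).toLinearMap c) U ∧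
        ∀ y ∈ U, dEuclidean (fun z => pullback Q (fderiv ℝ ψ z).toLinearMap c) y = 0) →
      (SmoothOn (fun z => pullback Q (fderiv ℝ ψ z).toLinearMap c') U ∧
        ∀ y ∈ U, dEuclidean (fun z => pullback Q (fderiv ℝ ψ z).toLinearMap c') y = 0) →
      (SmoothOn (fun z => pullback Q (fderiv ℝ ψ z).toLinearMap (c * c')) U ∧
        ∀ y ∈ U, dEuclidean (fun z => pullback Q (fderiv ℝ ψ z).toLinearMap (c * c')) y = 0) := by
    rintro c c' ⟨h1, h2⟩ ⟨h3, h4⟩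
    simp only [map_mul]
    refine ⟨h1.mul h3, fun y hy => ?_⟩
    rw [dEuclidean_mul h1 h3 hU hy, h2 y hy, h4 y hy, zero_mul, mul_zero, add_zero]
  have hadd : ∀ c c' : Fiber Q (EuclideanSpace ℝ (Fin n)),
      (SmoothOn (fun z => pullback Q (fderiv ℝ ψ z).toLinearMap c) U ∧
        ∀ y ∈ U, dEuclidean (fun z => pullback Q (fderiv ℝ ψ z).toLinearMap c) y = 0) →
      (SmoothOn (fun z => pullback Q (fderiv ℝ ψ z).toLinearMap c') U ∧
        ∀ y ∈ U, dEuclidean (fun z => pullback Q (fderiv ℝ ψ z).toLinearMap c') y = 0) →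
      (SmoothOn (fun z => pullback Q (fderiv ℝ ψ z).toLinearMap (c + c')) U ∧
        ∀ y ∈ U, dEuclidean (fun z => pullback Q (fderiv ℝ ψ z).toLinearMap (c + c')) y = 0) := by
    rintro c c' ⟨h1, h2⟩ ⟨h3, h4⟩
    simp only [map_add]
    refine ⟨h1.add h3, fun y hy => ?_⟩
    rw [dEuclidean_add h1 h3 hU hy, h2 y hy, h4 y hy, add_zero]
  induction c using TensorProduct.induction_on with
  | zero =>
    simp only [map_zero]
    exact ⟨SmoothOn.const 0, fun y _ => dEuclidean_const 0⟩
  | add c c' h h' => exact hadd c c' h h'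
  | tmul a α =>
    have h1 : a ⊗ₜ[ℝ] α = (a ⊗ₜ[ℝ] 1 : Fiber Q (EuclideanSpace ℝ (Fin n))) * (1 ⊗ₜ[ℝ] α) := by
      rw [Algebra.TensorProduct.tmul_mul_tmul, mul_one, one_mul]
    rw [h1]
    clear h1
    apply hmul
    · simp only [pullback_tmul, map_one]
      exact ⟨SmoothOn.const _, fun y _ => dEuclidean_const _⟩
    · induction α using ExteriorAlgebra.induction with
      | algebraMap r =>
        simp only [pullback_tmul, AlgHom.commutes]
        exact ⟨SmoothOn.const _, fun y _ => dEuclidean_const _⟩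
      | mul α β hα hβ =>
        have := hmul _ _ hα hβ
        rwa [Algebra.TensorProduct.tmul_mul_tmul, one_mul] at this
      | add α β hα hβ =>
        have := hadd _ _ hα hβ
        rwa [← TensorProduct.tmul_add] at this
      | ι d =>
        have hd : ContDiff ℝ ((⊤ : ℕ∞) : WithTop ℕ∞) d :=
          (LinearMap.toContinuousLinearMap d).contDiff
        have hdψ : ContDiffOn ℝ ((⊤ : ℕ∞) : WithTop ℕ∞) (fun z => d (ψ z)) U :=
          hd.comp_contDiffOn hψ
        have hs : SmoothOn (fun z => d (ψ z) • (1 : Fiber Q (EuclideanSpace ℝ (Fin n)))) U :=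
          SmoothOn.smul hdψ (SmoothOn.const 1)
        -- The pullback of the constant one-form `d` is the differential of `d ∘ ψ`, hence smooth,
        -- and closed by `d² = 0`.
        have key : ∀ z ∈ U, pullback Q (fderiv ℝ ψ z).toLinearMap
            (1 ⊗ₜ[ℝ] ExteriorAlgebra.ι ℝ d) =
            dEuclidean (fun z => d (ψ z) • (1 : Fiber Q (EuclideanSpace ℝ (Fin n)))) z := by
          intro z hz
          rw [dEuclidean_smul hdψ (SmoothOn.const 1) hU hz, dEuclidean_const, smul_zero, add_zero,
            mul_one, ← pullback_scalarD (hd.differentiable (by simp) _)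
              ((hψ.contDiffAt (hU.mem_nhds hz)).differentiableAt (by simp)), scalarD]
          have : fderiv ℝ (fun z => d z) (ψ z) = LinearMap.toContinuousLinearMap d :=
            (LinearMap.toContinuousLinearMap d).fderiv
          rw [this]
          rfl
        refine ⟨(hs.dEuclidean hU).congr key, fun y hy => ?_⟩
        rw [dEuclidean_congr (eventually_of_mem (hU.mem_nhds hy) key),
          dEuclidean_dEuclidean hs hU hy]

/-- The exterior derivative commutes with pullbacks. -/
theorem dEuclidean_pullback (hU : IsOpen U) (hU' : IsOpen U')
    (hψ : ContDiffOn ℝ ((⊤ : ℕ∞) : WithTop ℕ∞) ψ U) (hmap : Set.MapsTo ψ U U')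
    (hf : SmoothOn f U') (hy : y ∈ U) :
    dEuclidean (fun z => pullback Q (fderiv ℝ ψ z).toLinearMap (f (ψ z))) y =
      pullback Q (fderiv ℝ ψ y).toLinearMap (dEuclidean f (ψ y)) := by
  -- In a basis of constant forms only the scalar coefficients are differentiated: the pullbacks of
  -- the basis elements are closed, and the coefficients obey the chain rule.
  set b := Module.finBasis ℝ (Fiber Q (EuclideanSpace ℝ (Fin n)))
  have hf' : f = fun z => ∑ j, b.coord j (f z) • b j := by
    funext z
    exact (b.sum_repr (f z)).symm
  have hr : ∀ j, ContDiffOn ℝ ((⊤ : ℕ∞) : WithTop ℕ∞) (fun z => b.coord j (f (ψ z))) U :=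
    fun j => (hf (b.coord j)).comp hψ hmap
  have hc := fun j => pullback_const_closed (Q := Q) hU hψ (b j)
  have h1 : (fun z => pullback Q (fderiv ℝ ψ z).toLinearMap (f (ψ z))) = fun z =>
      ∑ j, b.coord j (f (ψ z)) • pullback Q (fderiv ℝ ψ z).toLinearMap (b j) := by
    funext z
    conv_lhs => rw [hf']
    simp only [map_sum, map_smul]
  rw [h1, dEuclidean_sum (fun j => SmoothOn.smul (hr j) (hc j).1) hU hy]
  have h2 : dEuclidean f (ψ y) = ∑ j, scalarD Q (fun z => b.coord j (f z)) (ψ y) * b j := by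
    conv_lhs => rw [hf']
    rw [dEuclidean_sum (fun j => SmoothOn.smul (hf (b.coord j)) (SmoothOn.const (b j))) hU'
      (hmap hy)]
    refine Finset.sum_congr rfl fun j _ => ?_
    rw [dEuclidean_smul (hf (b.coord j)) (SmoothOn.const (b j)) hU' (hmap hy), dEuclidean_const,
      smul_zero, add_zero]
  rw [h2, map_sum]
  refine Finset.sum_congr rfl fun j _ => ?_
  rw [dEuclidean_smul (hr j) (hc j).1 hU hy, (hc j).2 y hy, smul_zero, add_zero, map_mul,
    pullback_scalarD (hf.differentiableAt hU' (hmap hy) _)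
      ((hψ.contDiffAt (hU.mem_nhds hy)).differentiableAt (by simp))]

end ExteriorDerivative
-- Coordinate expressions of sums and products of forms.
section ChartAlgebra

variable {n : ℕ} {M : Type*} [TopologicalSpace M] [ChartedSpace (EuclideanSpace ℝ (Fin n)) M]

/-- The domain, in the chart at `x`, of the coordinate change to the chart at `p`. -/
def overlap (x p : M) : Set (EuclideanSpace ℝ (Fin n)) :=
  (extChartAt (𝓡 n) x).target ∩ (extChartAt (𝓡 n) x).symm ⁻¹' (extChartAt (𝓡 n) p).source

theorem isOpen_overlap (x p : M) : IsOpen (overlap (n := n) x p) :=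
  (continuousOn_extChartAt_symm x).isOpen_inter_preimage (isOpen_extChartAt_target x)
    (isOpen_extChartAt_source p)

variable {V : Type*} [AddCommGroup V] [Module ℝ V] {Q : QuadraticForm ℝ V}
  {α β : Field n M Q}

theorem inChart_add (α β : Field n M Q) (x : M) (y : EuclideanSpace ℝ (Fin n)) :
    inChart (α + β) x y = inChart α x y + inChart β x y :=
  map_add (pullback Q _) _ _

theorem inChart_mul (α β : Field n M Q) (x : M) (y : EuclideanSpace ℝ (Fin n)) :
    inChart (α * β) x y = inChart α x y * inChart β x y :=
  map_mul (pullback Q _) _ _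

/-- Smoothness of a Clifford form in all charts. -/
def Smooth (α : Field n M Q) : Prop :=
  ∀ x : M, SmoothOn (inChart α x) (extChartAt (𝓡 n) x).target

theorem Smooth.add (hα : Smooth α) (hβ : Smooth β) : Smooth (α + β) := fun x =>
  ((hα x).add (hβ x)).congr fun z _ => inChart_add α β x z

variable [FiniteDimensional ℝ V]

theorem Smooth.mul (hα : Smooth α) (hβ : Smooth β) : Smooth (α * β) := fun x =>
  ((hα x).mul (hβ x)).congr fun z _ => inChart_mul α β x z

theorem extD_add (hα : Smooth α) (hβ : Smooth β) : extD (α + β) = extD α + extD β := by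
  funext x
  have hx := mem_extChartAt_target (I := 𝓡 n) x
  have h : inChart (α + β) x = fun y => inChart α x y + inChart β x y :=
    funext fun y => inChart_add α β x y
  rw [Pi.add_apply, extD, h, dEuclidean_add (hα x) (hβ x) (isOpen_extChartAt_target x) hx]
  exact map_add (pullback Q _) _ _

theorem extD_zero : extD (0 : Field n M Q) = 0 := by
  funext x
  have h : inChart (0 : Field n M Q) x = fun _ => 0 := funext fun y => map_zero (pullback Q _)
  rw [extD, h, dEuclidean_const]
  exact map_zero (pullback Q _)

end ChartAlgebra

/-! ### Changes of chart and the rules for `extD` on the manifold. -/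

section Charts

open Filter Topology

variable {n : ℕ} {M : Type*} [TopologicalSpace M] [ChartedSpace (EuclideanSpace ℝ (Fin n)) M]
  [IsManifold (𝓡 n) ((⊤ : ℕ∞) : WithTop ℕ∞) M]

theorem mfderiv_extChartAt_symm_comp (x : M) {y : EuclideanSpace ℝ (Fin n)}
    (hy : y ∈ (extChartAt (𝓡 n) x).target) :
    (mfderiv (𝓡 n) (𝓡 n) (extChartAt (𝓡 n) x).symm y).comp
      (mfderiv (𝓡 n) (𝓡 n) (extChartAt (𝓡 n) x) ((extChartAt (𝓡 n) x).symm y)) =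
        ContinuousLinearMap.id ℝ _ := by
  have : IsManifold (𝓡 n) 1 M := .of_le (n := ((⊤ : ℕ∞) : WithTop ℕ∞)) (by simp)
  have := mfderivWithin_extChartAt_symm_comp_mfderiv_extChartAt (I := 𝓡 n) hy
  rwa [ModelWithCorners.range_eq_univ, mfderivWithin_univ] at this

theorem mfderiv_extChartAt_comp_symm (x : M) {y : EuclideanSpace ℝ (Fin n)}
    (hy : y ∈ (extChartAt (𝓡 n) x).target) :
    (mfderiv (𝓡 n) (𝓡 n) (extChartAt (𝓡 n) x) ((extChartAt (𝓡 n) x).symm y)).comp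
      (mfderiv (𝓡 n) (𝓡 n) (extChartAt (𝓡 n) x).symm y) =
        ContinuousLinearMap.id ℝ _ := by
  have : IsManifold (𝓡 n) 1 M := .of_le (n := ((⊤ : ℕ∞) : WithTop ℕ∞)) (by simp)
  have := mfderiv_extChartAt_comp_mfderivWithin_extChartAt_symm (I := 𝓡 n) hy
  rwa [ModelWithCorners.range_eq_univ, mfderivWithin_univ] at this

theorem mdifferentiableAt_extChartAt_symm (x : M) {y : EuclideanSpace ℝ (Fin n)}
    (hy : y ∈ (extChartAt (𝓡 n) x).target) :
    MDifferentiableAt (𝓡 n) (𝓡 n) (extChartAt (𝓡 n) x).symm y := by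
  have : IsManifold (𝓡 n) 1 M := .of_le (n := ((⊤ : ℕ∞) : WithTop ℕ∞)) (by simp)
  have := mdifferentiableWithinAt_extChartAt_symm (I := 𝓡 n) hy
  rwa [ModelWithCorners.range_eq_univ, mdifferentiableWithinAt_univ] at this

theorem contDiffOn_overlap (x p : M) :
    ContDiffOn ℝ ((⊤ : ℕ∞) : WithTop ℕ∞)
      (fun y => extChartAt (𝓡 n) p ((extChartAt (𝓡 n) x).symm y)) (overlap x p) := by
  refine (contDiffOn_ext_coord_change (I := 𝓡 n) p x).mono fun y hy => ?_
  rw [ext_coord_change_source]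
  simpa [overlap] using hy

theorem mdifferentiableAt_extChartAt' (x : M) {p : M} (hp : p ∈ (extChartAt (𝓡 n) x).source) :
    MDifferentiableAt (𝓡 n) (𝓡 n) (extChartAt (𝓡 n) x) p := by
  have : IsManifold (𝓡 n) 1 M := .of_le (n := ((⊤ : ℕ∞) : WithTop ℕ∞)) (by simp)
  exact mdifferentiableAt_extChartAt (by simpa using hp)

theorem fderiv_coord_change (x p : M) {y : EuclideanSpace ℝ (Fin n)} (hy : y ∈ overlap x p) :
    fderiv ℝ (fun y => extChartAt (𝓡 n) p ((extChartAt (𝓡 n) x).symm y)) y =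
    (mfderiv (𝓡 n) (𝓡 n) (extChartAt (𝓡 n) p) ((extChartAt (𝓡 n) x).symm y)).comp
      (mfderiv (𝓡 n) (𝓡 n) (extChartAt (𝓡 n) x).symm y) := by
  rw [← mfderiv_eq_fderiv]
  exact mfderiv_comp y (mdifferentiableAt_extChartAt' p hy.2)
    (mdifferentiableAt_extChartAt_symm x hy.1)

variable {V : Type*} [AddCommGroup V] [Module ℝ V] {Q : QuadraticForm ℝ V}
  {α β : Field n M Q}

theorem pullback_inChart_symm (α : Field n M Q) (x : M) {y : EuclideanSpace ℝ (Fin n)}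
    (hy : y ∈ (extChartAt (𝓡 n) x).target) :
    pullback Q (T := TangentSpace (𝓡 n) ((extChartAt (𝓡 n) x).symm y))
      (T' := EuclideanSpace ℝ (Fin n))
      (mfderiv (𝓡 n) (𝓡 n) (extChartAt (𝓡 n) x) ((extChartAt (𝓡 n) x).symm y)).toLinearMap
      (inChart α x y) = α ((extChartAt (𝓡 n) x).symm y) := by
  have := congrArg ContinuousLinearMap.toLinearMap (mfderiv_extChartAt_symm_comp x hy)
  refine (pullback_pullback _ _ _).trans ?_
  refine (congrArg (fun L => pullback Q L (α ((extChartAt (𝓡 n) x).symm y))) this).trans ?_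
  exact pullback_id _

theorem pullback_inChart (α : Field n M Q) (x : M) {p : M}
    (hp : p ∈ (extChartAt (𝓡 n) x).source) :
    pullback Q (T := TangentSpace (𝓡 n) p) (T' := EuclideanSpace ℝ (Fin n))
      (mfderiv (𝓡 n) (𝓡 n) (extChartAt (𝓡 n) x) p).toLinearMap
      (inChart α x (extChartAt (𝓡 n) x p)) = α p := by
  obtain ⟨y, hy, rfl⟩ : ∃ y ∈ (extChartAt (𝓡 n) x).target, (extChartAt (𝓡 n) x).symm y = p :=
    ⟨_, (extChartAt (𝓡 n) x).map_source hp, (extChartAt (𝓡 n) x).left_inv hp⟩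
  rw [(extChartAt (𝓡 n) x).right_inv hy]
  exact pullback_inChart_symm α x hy

theorem inChart_coord_change (α : Field n M Q) (x p : M) {y : EuclideanSpace ℝ (Fin n)}
    (hy : y ∈ overlap x p) :
    inChart α x y = pullback Q
      (fderiv ℝ (fun y => extChartAt (𝓡 n) p ((extChartAt (𝓡 n) x).symm y)) y).toLinearMap
      (inChart α p (extChartAt (𝓡 n) p ((extChartAt (𝓡 n) x).symm y))) := by
  conv_lhs => rw [inChart, ← pullback_inChart α p hy.2]
  rw [fderiv_coord_change x p hy]
  exact pullback_pullback _ _ _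

theorem ext_inChart (h : ∀ x : M, inChart α x (extChartAt (𝓡 n) x x) =
    inChart β x (extChartAt (𝓡 n) x x)) : α = β := by
  funext x
  rw [← pullback_inChart α x (mem_extChartAt_source x),
    ← pullback_inChart β x (mem_extChartAt_source x), h]

variable [FiniteDimensional ℝ V]

/-- Independence of the chart. The definition uses a different chart at each point, whereas
iterating `d` requires one chart on a whole neighbourhood; naturality of `dEuclidean` under the
coordinate change bridges the two. -/
theorem extD_eq_pullback (hα : Smooth α) (x : M) {p : M}
    (hp : p ∈ (extChartAt (𝓡 n) x).source) :
    extD α p = pullback Q (T := TangentSpace (𝓡 n) p) (T' := EuclideanSpace ℝ (Fin n))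
      (mfderiv (𝓡 n) (𝓡 n) (extChartAt (𝓡 n) x) p).toLinearMap
      (dEuclidean (inChart α x) (extChartAt (𝓡 n) x p)) := by
  have hl := (extChartAt (𝓡 n) x).left_inv hp
  have hz : extChartAt (𝓡 n) x p ∈ overlap x p :=
    ⟨(extChartAt (𝓡 n) x).map_source hp, by
      rw [Set.mem_preimage, hl]; exact mem_extChartAt_source p⟩
  rw [dEuclidean_congr (eventually_of_mem ((isOpen_overlap x p).mem_nhds hz)
      fun z hz => inChart_coord_change α x p hz),
    dEuclidean_pullback (isOpen_overlap x p) (isOpen_extChartAt_target p) (contDiffOn_overlap x p)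
      (fun z hz => (extChartAt (𝓡 n) p).map_source hz.2) (hα p) hz, hl]
  -- Chain rule: near `p` the chart at `p` is the coordinate change composed with the chart at `x`.
  have hc : mfderiv (𝓡 n) (𝓡 n) (extChartAt (𝓡 n) p) p =
      (fderiv ℝ (fun y => extChartAt (𝓡 n) p ((extChartAt (𝓡 n) x).symm y))
        (extChartAt (𝓡 n) x p)).comp (mfderiv (𝓡 n) (𝓡 n) (extChartAt (𝓡 n) x) p) := by
    rw [← mfderiv_eq_fderiv]
    have hd : MDifferentiableAt (𝓡 n) (𝓡 n)
        (fun y => extChartAt (𝓡 n) p ((extChartAt (𝓡 n) x).symm y)) (extChartAt (𝓡 n) x p) :=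
      (((contDiffOn_overlap x p).contDiffAt ((isOpen_overlap x p).mem_nhds hz)).differentiableAt
        (by simp)).mdifferentiableAt
    have := mfderiv_comp p hd (mdifferentiableAt_extChartAt' x hp)
    refine Eq.trans ?_ this
    refine Filter.EventuallyEq.mfderiv_eq ?_
    refine eventually_of_mem ((isOpen_extChartAt_source (I := 𝓡 n) x).mem_nhds hp) fun q hq => ?_
    simp only [Function.comp_apply]
    rw [(extChartAt (𝓡 n) x).left_inv hq]
  have hc' := congrArg ContinuousLinearMap.toLinearMap hc
  rw [extD]
  refine (congrArg (fun L => pullback Q (T := TangentSpace (𝓡 n) p)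
    (T' := EuclideanSpace ℝ (Fin n)) L _) hc').trans ?_
  exact (pullback_pullback _ _ _).symm

theorem inChart_extD (hα : Smooth α) (x : M) {y : EuclideanSpace ℝ (Fin n)}
    (hy : y ∈ (extChartAt (𝓡 n) x).target) :
    inChart (extD α) x y = dEuclidean (inChart α x) y := by
  rw [inChart, extD_eq_pullback hα x ((extChartAt (𝓡 n) x).map_target hy),
    (extChartAt (𝓡 n) x).right_inv hy]
  have := congrArg ContinuousLinearMap.toLinearMap (mfderiv_extChartAt_comp_symm x hy)
  refine (pullback_pullback _ _ _).trans ?_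
  refine (congrArg (fun L => pullback Q L (dEuclidean (inChart α x) y)) this).trans ?_
  exact pullback_id _

theorem Smooth.extD (hα : Smooth α) : Smooth (extD α) := fun x =>
  ((hα x).dEuclidean (isOpen_extChartAt_target x)).congr fun _ hz => inChart_extD hα x hz

theorem extD_extD (hα : Smooth α) : extD (extD α) = 0 := by
  refine ext_inChart fun x => ?_
  have hx := mem_extChartAt_target (I := 𝓡 n) x
  rw [inChart_extD hα.extD x hx, dEuclidean_congr
    (eventually_of_mem ((isOpen_extChartAt_target x).mem_nhds hx)
      fun z hz => inChart_extD hα x hz), dEuclidean_dEuclidean (hα x)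
      (isOpen_extChartAt_target x) hx]
  exact (map_zero (pullback Q _)).symm

theorem extD_mul (hα : Smooth α) (hβ : Smooth β) (x : M) :
    extD (α * β) x = extD α x * β x + formSign (α x) * extD β x := by
  have hx := mem_extChartAt_target (I := 𝓡 n) x
  have h : inChart (α * β) x = fun y => inChart α x y * inChart β x y :=
    funext fun y => inChart_mul α β x y
  conv_rhs => rw [← pullback_inChart α x (mem_extChartAt_source x),
    ← pullback_inChart β x (mem_extChartAt_source x)]
  rw [extD, h, dEuclidean_mul (hα x) (hβ x) (isOpen_extChartAt_target x) hx]
  refine (map_add (pullback Q _) _ _).trans ?_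
  refine congrArg₂ (· + ·) (map_mul (pullback Q _) _ _) ((map_mul (pullback Q _) _ _).trans ?_)
  exact congrArg (· * _) (pullback_formSign _ _)

end Charts
-- Bidegrees of torsion and curvature, and the torsion Bianchi identity.
section Forms

variable {n : ℕ} {M : Type*} [TopologicalSpace M] [ChartedSpace (EuclideanSpace ℝ (Fin n)) M]
  {V : Type*} [AddCommGroup V] [Module ℝ V] {Q : QuadraticForm ℝ V}
  {α : Field n M Q} {p q : ℕ}

theorem IsForm.of_smooth (hα : Smooth α)
    (h : ∀ x, α x ∈ CliffordForms.bidegree Q (TangentSpace (𝓡 n) x) p q) : IsForm α p q :=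
  ⟨h, hα⟩

theorem IsForm.inChart_mem_bidegree (hα : IsForm α p q) (x : M) (y : EuclideanSpace ℝ (Fin n)) :
    inChart α x y ∈ CliffordForms.bidegree Q (EuclideanSpace ℝ (Fin n)) p q :=
  pullback_mem_bidegree _ (hα.bidegree _)

variable [FiniteDimensional ℝ V]

theorem IsForm.extD_mem_bidegree (hα : IsForm α p q) (x : M) :
    extD α x ∈ CliffordForms.bidegree Q (TangentSpace (𝓡 n) x) p (q + 1) :=
  pullback_mem_bidegree _ (dEuclidean_mem_bidegree (hα.smooth x) (isOpen_extChartAt_target x)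
    (mem_extChartAt_target x) fun z _ => hα.inChart_mem_bidegree x z)

variable [IsManifold (𝓡 n) ((⊤ : ℕ∞) : WithTop ℕ∞) M] {θ ω : Field n M Q}

theorem isForm_torsion (hθ : IsForm θ 1 1) (hω : IsForm ω 2 1) : IsForm (torsion θ ω) 1 2 := by
  have hsθ : Smooth θ := hθ.smooth
  have hsω : Smooth ω := hω.smooth
  refine IsForm.of_smooth ((hsθ.extD.add (hsω.mul hsθ)).add (hsθ.mul hsω)) fun x => ?_
  rw [torsion, add_assoc]
  exact add_mem (hθ.extD_mem_bidegree x)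
    (mul_add_mul_mem_bidegree_one_two (hω.bidegree x) (hθ.bidegree x))

theorem isForm_curvature (hω : IsForm ω 2 1) : IsForm (curvature ω) 2 2 := by
  have hsω : Smooth ω := hω.smooth
  refine IsForm.of_smooth (hsω.extD.add (hsω.mul hsω)) fun x => ?_
  exact add_mem (hω.extD_mem_bidegree x) (mul_self_mem_bidegree_two_two (hω.bidegree x))

theorem covD_torsion (hθ : IsForm θ 1 1) (hω : IsForm ω 2 1) (x : M) :
    covD ω (torsion θ ω) x =
      extD (torsion θ ω) x + ω x * torsion θ ω x - torsion θ ω x * ω x := by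
  rw [covD, formSign_of_mem_bidegree ((isForm_torsion hθ hω).bidegree x), neg_one_sq, one_smul]

/-- The Bianchi identity for the torsion. -/
theorem extD_torsion_add_commutator (hθ : IsForm θ 1 1) (hω : IsForm ω 2 1) (x : M) :
    extD (torsion θ ω) x + ω x * torsion θ ω x - torsion θ ω x * ω x =
      curvature ω x * θ x - θ x * curvature ω x := by
  have hsθ : Smooth θ := hθ.smooth
  have hsω : Smooth ω := hω.smooth
  have h : extD (torsion θ ω) = extD (extD θ) + extD (ω * θ) + extD (θ * ω) := by
    rw [← extD_add hsθ.extD (hsω.mul hsθ), ← extD_add (hsθ.extD.add (hsω.mul hsθ)) (hsθ.mul hsω)]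
    rfl
  rw [h, Pi.add_apply, Pi.add_apply, extD_extD hsθ, extD_mul hsω hsθ, extD_mul hsθ hsω,
    formSign_of_mem_bidegree (hθ.bidegree x), formSign_of_mem_bidegree (hω.bidegree x), pow_one,
    neg_one_smul, neg_one_smul, torsion, curvature, Pi.zero_apply]
  -- With `d²θ = 0`, the terms `ω dθ`, `dθ ω` and `ωθω` occur in pairs of opposite sign; `dω` and
  -- `ω²` remain in a commutator with `θ`.
  noncomm_ring

end Forms
end CliffordForms

/-! ### The main theorem. -/

open CliffordForms in
theorem mainTheorem7 {n : ℕ} {M : Type*} [TopologicalSpace M]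
    [ChartedSpace (EuclideanSpace ℝ (Fin n)) M] [IsManifold (𝓡 n) ((⊤ : ℕ∞) : WithTop ℕ∞) M]
    {V : Type*} [AddCommGroup V] [Module ℝ V] [FiniteDimensional ℝ V]
    (hV : Module.finrank ℝ V = n)
    (Q : QuadraticForm ℝ V) (hQ : (eta Q).Nondegenerate)
    (vol : (CliffordAlgebra Q)ˣ) (hvol : (vol : CliffordAlgebra Q) ∈ clPart Q n)
    (θ ω : CliffordForms.Field n M Q) (hθ : IsForm θ 1 1) (hω : IsForm ω 2 1)
    (e : ∀ x : M, TangentSpace (𝓡 n) x ≃ₗ[ℝ] V) (he : Induces θ e) :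
    IsForm (torsion θ ω) 1 2 ∧ IsForm (curvature ω) 2 2 ∧
    (∀ x : M,
      covD ω (torsion θ ω) x =
        extD (torsion θ ω) x + ω x * torsion θ ω x - torsion θ ω x * ω x ∧
      covD ω (torsion θ ω) x = curvature ω x * θ x - θ x * curvature ω x ∧
      covD ω (torsion θ ω) x = (-2 : ℝ) • opE' vol (θ x) (curvature ω x)) ∧
    ((∀ x : M, torsion θ ω x = 0) → ∀ x : M,
      opE' vol (θ x) (curvature ω x) = 0 ∧
      opF' hQ vol (e x) (θ x) (curvature ω x) = 0 ∧
      opH' (curvature ω x) = 0 ∧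
      toTensor hQ (e x) (curvature ω x) ∈
        LinearMap.range (TensorProduct.map (⋀[ℝ]^2 V).subtype (⋀[ℝ]^2 V).subtype) ∧
      TensorProduct.comm ℝ _ _ (toTensor hQ (e x) (curvature ω x)) =
        toTensor hQ (e x) (curvature ω x)) := by
  rw [← hV] at hvol
  have hR := isForm_curvature hω
  have h1 := fun x => covD_torsion hθ hω x
  have h2 : ∀ x, covD ω (torsion θ ω) x = curvature ω x * θ x - θ x * curvature ω x :=
    fun x => (h1 x).trans (extD_torsion_add_commutator hθ hω x)
  have h3 : ∀ x, covD ω (torsion θ ω) x = (-2 : ℝ) • opE' vol (θ x) (curvature ω x) :=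
    fun x => (h2 x).trans
      (commutator_soldering_eq_opE' vol hvol (e x) (hθ.bidegree x) (he x) (hR.bidegree x))
  refine ⟨isForm_torsion hθ hω, hR, fun x => ⟨h1 x, h2 x, h3 x⟩, fun ht x => ?_⟩
  have hE : opE' vol (θ x) (curvature ω x) = 0 := by
    -- The torsion must vanish on all of `M`, not only at `x`, for its derivative at `x` to vanish.
    have h0 : extD (torsion θ ω) x = 0 := by
      rw [show torsion θ ω = 0 from funext ht, extD_zero]
      rfl
    have h4 := (h3 x).symm.trans (h1 x)
    rw [h0, ht x, mul_zero, zero_mul, add_zero, sub_zero] at h4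
    exact (smul_eq_zero.1 h4).resolve_left (by norm_num)
  refine ⟨hE, opF'_eq_zero_of_opE'_eq_zero hQ vol hvol (e x) (hθ.bidegree x) (he x)
    (hR.bidegree x) hE, ?_, toTensor_mem_range hQ (e x) (hR.bidegree x),
    comm_toTensor_of_opE'_eq_zero hQ vol hvol (e x) (hθ.bidegree x) (he x) (hR.bidegree x) hE⟩
  rw [opH'_of_mem_bidegree (hR.bidegree x), sub_self, zero_smul]
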